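/- Let $l\ge 1$. For a field $k$ with $\operatorname{char} k\ne 2$ and a matrix $\beta$ let the similitude group of $\beta$ consist of the invertible $g$ with ${}^T g\beta g=\mu(g)\beta$ for some $\mu(g)\in k^\times$. Let $\mathrm{GSp}(2l,k)$, $\mathrm{GO}(2l,k)$, $\mathrm{GO}(2l+1,k)$ be the similitude groups of $$\begin{pmatrix}0&I_l\\-I_l&0\end{pmatrix},\qquad \begin{pmatrix}0&I_l\\I_l&0\end{pmatrix},\qquad \begin{pmatrix}2&0&0\\0&0&I_l\\0&I_l&0\end{pmatrix}$$ (rows and columns indexed by $1,\dots,l,-1,\dots,-l$, preceded by $0$ in the odd case), and, for a finite field $k=\mathbb F_q$ of odd characteristic and a non-square $\epsilon\in k^\times$, let $\mathrm{GO}^-(2l,q)$ be the similitude group of $\operatorname{diag}(1,\epsilon)\oplus\begin{pmatrix}0&I_{l-1}\\I_{l-1}&0\end{pmatrix}$ (indices $1,-1,2,\dots,l,-2,\dots,-l$). With $e_{i,j}$ the matrix units and $t,s\in k$, the elementary matrices are the following. * All groups, with $1\le i,j\le l$ (and $2\le i,j\le l$ for $\mathrm{GO}^-$): $x_{i,j}(t)=I+t(e_{i,j}-e_{-j,-i})$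 for $i\ne j$, and for $i<j$: $x_{i,-j}(t)=I+t(e_{i,-j}\mp e_{j,-i})$ and $x_{-i,j}(t)=I+t(e_{-i,j}\mp e_{-j,i})$, with the sign $+$ for $\mathrm{GSp}$ and $-$ for the orthogonal groups. * $\mathrm{GSp}(2l,k)$: also $x_{i,-i}(t)=I+te_{i,-i}$ and $x_{-i,i}(t)=I+te_{-i,i}$. * $\mathrm{GO}(2l,k)$ and $\mathrm{GO}(2l+1,k)$: also $w_l$, where $w_i=I-e_{i,i}-e_{-i,-i}-e_{i,-i}-e_{-i,i}$. * $\mathrm{GO}(2l+1,k)$: also $x_{i,0}(t)=I+t(2e_{i,0}-e_{0,-i})-t^2e_{i,-i}$ and $x_{0,i}(t)=I+t(-2e_{-i,0}+e_{0,i})-t^2e_{-i,i}$. * $\mathrm{GO}^-(2l,q)$: also, for $2\le i\le l$, $x_{i,1}(t)=I+t(-e_{-i,1}+e_{1,i})-\tfrac{t^2}{2}e_{-i,i}$, $x_{1,i}(t)=I+t(e_{i,1}-e_{1,-i})-\tfrac{t^2}{2}e_{i,-i}$, $x_{i,-1}(t)=I+t(-\epsilon e_{-i,-1}+e_{-1,i})-\tfrac{\epsilon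 t^2}{2}e_{-i,i}$, $x_{-1,i}(t)=I+t(\epsilon e_{i,-1}-e_{-1,-i})-\tfrac{\epsilon t^2}{2}e_{i,-i}$, $w_i$, and moreover $x_1(t,s)=I+(t-1)e_{1,1}-(t+1)e_{-1,-1}+s(e_{-1,1}+\epsilon e_{1,-1})$ and $x_2=I-2e_{-1,-1}$. **Theorem A.** There is an absolute constant $C$ such that every element $g$ of one of these groups can be written as $g=WD$, where $W$ is a product of at most $C\,l^3$ elementary matrices of that group and $D$ is a diagonal matrix, namely, for suitable $\alpha,\lambda\in k^\times$: * $D=\operatorname{diag}(1,\dots,1,\mu(g),\dots,\mu(g))$ for $\mathrm{GSp}(2l,k)$; * $D=\operatorname{diag}(1,\dots,1,\lambda,\mu(g),\dots,\mu(g),\mu(g)\lambda^{-1})$ for $\mathrm{GO}(2l,k)$; * $D=\operatorname{diag}(\alpha,1,\dots,1,\lambda,\mu(g),\dots,\mu(g),\mu(g)\lambda^{-1})$ with $\alpha^2=\mu(g)$ for $\mathrm{GO}(2l+1,k)$; * $D=\operatorname{diag}(1,1,1,\dots,1,\lambda,\mu(g),\dots,\mu(g),\mu(g)\lambda^{-1})$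 for $\mathrm{GO}^-(2l,q)$ (with $D=I_2$ when $l=1$); here every letter $x_1(t,s)$ in $W$ satisfies $t^2+\epsilon s^2=\mu(g)$. Moreover, the word is produced by a Gaussian elimination algorithm: for each of the four types and each $l$ there is a finite decision tree, independent of the field $k$, of $\epsilon$ and of $g$, which, started at the matrix $g$, at each step either tests whether an arithmetic expression (formed with $+$, $\cdot$, inversion with the convention $0^{-1}=0$, and integers, and $\epsilon$ in the twisted case) in the entries of the current matrix $M$ vanishes, or computes an elementary matrix $E$ whose parameters are such expressions, appends $E$ to the word, and replaces $M$ by $E^{-1}M$; it ends with the word $W$ and with $M=D$. -/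

import Mathlib

open Matrix

namespace SimilitudeWord

/-! ## Similitude groups of a bilinear form -/

section Similitude

variable {ι : Type*} [Fintype ι] [DecidableEq ι] {k : Type*} [Field k]

/-- `c` is a multiplier of `g` for the form with matrix `β`: `ᵗg β g = c β`. -/
def HasMultiplier (β : Matrix ι ι k) (g : GL ι k) (c : kˣ) : Prop :=
  (g : Matrix ι ι k)ᵀ * β * (g : Matrix ι ι k) = (c : k) • β

/-- The group of similitudes of the bilinear form with matrix `β`. -/
def similitudeGroup (β : Matrix ι ι k) : Subgroup (GL ι k) where
  carrier := {g | ∃ c : kˣ, HasMultiplier β g c}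
  one_mem' := ⟨1, by simp [HasMultiplier]⟩
  mul_mem' := by
    rintro g h ⟨c, hc⟩ ⟨d, hd⟩
    refine ⟨c * d, ?_⟩
    unfold HasMultiplier at *
    have : ((g * h : GL ι k) : Matrix ι ι k)ᵀ * β * ((g * h : GL ι k) : Matrix ι ι k)
        = (h : Matrix ι ι k)ᵀ * ((g : Matrix ι ι k)ᵀ * β * (g : Matrix ι ι k))
            * (h : Matrix ι ι k) := by
      simp [Matrix.mul_assoc, Matrix.transpose_mul]
    rw [this, hc, Matrix.mul_smul, Matrix.smul_mul, hd, smul_smul, Units.val_mul]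
  inv_mem' := by
    rintro g ⟨c, hc⟩
    refine ⟨c⁻¹, ?_⟩
    unfold HasMultiplier at *
    have h1 : (g : Matrix ι ι k) * ((g⁻¹ : GL ι k) : Matrix ι ι k) = 1 := by
      rw [← Units.val_mul, mul_inv_cancel, Units.val_one]
    have h2 : ((g⁻¹ : GL ι k) : Matrix ι ι k)ᵀ * (g : Matrix ι ι k)ᵀ = 1 := by
      rw [← Matrix.transpose_mul, h1, Matrix.transpose_one]
    have h3 : ((g⁻¹ : GL ι k) : Matrix ι ι k)ᵀ *
        ((g : Matrix ι ι k)ᵀ * β * (g : Matrix ι ι k)) * ((g⁻¹ : GL ι k) : Matrix ι ι k) = β := by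
      calc _ = (((g⁻¹ : GL ι k) : Matrix ι ι k)ᵀ * (g : Matrix ι ι k)ᵀ) * β *
            ((g : Matrix ι ι k) * ((g⁻¹ : GL ι k) : Matrix ι ι k)) := by
              simp only [Matrix.mul_assoc]
        _ = β := by rw [h1, h2, Matrix.one_mul, Matrix.mul_one]
    rw [hc, Matrix.mul_smul, Matrix.smul_mul] at h3
    calc _ = ((c⁻¹ : kˣ) : k) • ((c : k) • (((g⁻¹ : GL ι k) : Matrix ι ι k)ᵀ * β *
            ((g⁻¹ : GL ι k) : Matrix ι ι k))) := by
              rw [smul_smul, ← Units.val_mul, inv_mul_cancel, Units.val_one, one_smul]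
      _ = _ := by rw [h3]

end Similitude

/-! ## Index sets

`inl i` stands for the index `i` and `inr i` for the index `-i`. -/

/-- The indices `1, …, l, -1, …, -l`. -/
abbrev EvenIdx (l : ℕ) : Type := Fin l ⊕ Fin l

/-- The indices `0, 1, …, l, -1, …, -l`. -/
abbrev OddIdx (l : ℕ) : Type := Unit ⊕ (Fin l ⊕ Fin l)

/-- The indices `1, -1, 2, …, l, -2, …, -l` for `l = m + 1`: the element `0 : Fin 2` is the
index `1`, the element `1 : Fin 2` is the index `-1`, and `i : Fin m` is counted from `2`. -/
abbrev TwIdx (m : ℕ) : Type := Fin 2 ⊕ (Fin m ⊕ Fin m)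

/-! ## The forms and the groups -/

/-- The alternating form `(0, I; -I, 0)`. -/
def symplecticForm (l : ℕ) (k : Type*) [Field k] : Matrix (EvenIdx l) (EvenIdx l) k :=
  fromBlocks 0 1 (-1) 0

/-- The split symmetric form `(0, I; I, 0)`. -/
def evenForm (l : ℕ) (k : Type*) [Field k] : Matrix (EvenIdx l) (EvenIdx l) k :=
  fromBlocks 0 1 1 0

/-- The split symmetric form `(2) ⊕ (0, I; I, 0)`. -/
def oddForm (l : ℕ) (k : Type*) [Field k] : Matrix (OddIdx l) (OddIdx l) k :=
  fromBlocks (diagonal fun _ => 2) 0 0 (evenForm l k)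

/-- The symmetric form `diag(1, ε) ⊕ (0, I; I, 0)`. -/
def twistedForm (m : ℕ) {k : Type*} [Field k] (ε : k) : Matrix (TwIdx m) (TwIdx m) k :=
  fromBlocks (diagonal ![1, ε]) 0 0 (evenForm m k)

/-- `GSp(2l, k)`. -/
def GSp (l : ℕ) (k : Type*) [Field k] : Subgroup (GL (EvenIdx l) k) :=
  similitudeGroup (symplecticForm l k)

/-- `GO(2l, k)`. -/
def GOEven (l : ℕ) (k : Type*) [Field k] : Subgroup (GL (EvenIdx l) k) :=
  similitudeGroup (evenForm l k)

/-- `GO(2l+1, k)`. -/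
def GOOdd (l : ℕ) (k : Type*) [Field k] : Subgroup (GL (OddIdx l) k) :=
  similitudeGroup (oddForm l k)

/-- `GO⁻(2l, k)` for `l = m + 1` (used for a finite field `k` and a non-square `ε`). -/
def GOTwisted (m : ℕ) {k : Type*} [Field k] (ε : k) : Subgroup (GL (TwIdx m) k) :=
  similitudeGroup (twistedForm m ε)

/-! ## Elementary matrices

For every group there is a type of letters, with parameters in a type `R`, and the matrix of a
letter whose parameters lie in a field. Below, `e (i) (j)` is the matrix unit. -/

section Letters

variable {ι : Type*} [DecidableEq ι]

/-- The matrix unit `e_{i,j}`. -/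
def e {k : Type*} [Field k] (i j : ι) : Matrix ι ι k := Matrix.single i j 1

/-- Letters for `GSp(2l, k)`. -/
inductive GSpLetter (l : ℕ) (R : Type*)
  /-- `x_{i,j}(t)` -/
  | x (i j : Fin l) (h : i ≠ j) (t : R)
  /-- `x_{i,-j}(t)` -/
  | xUp (i j : Fin l) (h : i < j) (t : R)
  /-- `x_{-i,j}(t)` -/
  | xDown (i j : Fin l) (h : i < j) (t : R)
  /-- `x_{i,-i}(t)` -/
  | xUpDiag (i : Fin l) (t : R)
  /-- `x_{-i,i}(t)` -/
  | xDownDiag (i : Fin l) (t : R)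

/-- Change of the parameters of a letter. -/
def GSpLetter.map {l : ℕ} {R S : Type*} (f : R → S) : GSpLetter l R → GSpLetter l S
  | x i j h t => x i j h (f t)
  | xUp i j h t => xUp i j h (f t)
  | xDown i j h t => xDown i j h (f t)
  | xUpDiag i t => xUpDiag i (f t)
  | xDownDiag i t => xDownDiag i (f t)

/-- The elementary matrices of `GSp(2l, k)`. -/
def GSpLetter.toMatrix {l : ℕ} {k : Type*} [Field k] :
    GSpLetter l k → Matrix (EvenIdx l) (EvenIdx l) k
  | x i j _ t => 1 + t • (e (.inl i) (.inl j) - e (.inr j) (.inr i))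
  | xUp i j _ t => 1 + t • (e (.inl i) (.inr j) + e (.inl j) (.inr i))
  | xDown i j _ t => 1 + t • (e (.inr i) (.inl j) + e (.inr j) (.inl i))
  | xUpDiag i t => 1 + t • e (.inl i) (.inr i)
  | xDownDiag i t => 1 + t • e (.inr i) (.inl i)

/-- Letters for `GO(2l, k)`. -/
inductive GOEvenLetter (l : ℕ) (R : Type*)
  /-- `x_{i,j}(t)` -/
  | x (i j : Fin l) (h : i ≠ j) (t : R)
  /-- `x_{i,-j}(t)` -/
  | xUp (i j : Fin l) (h : i < j) (t : R)
  /-- `x_{-i,j}(t)` -/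
  | xDown (i j : Fin l) (h : i < j) (t : R)
  /-- `w_l`, where `i` is the last index -/
  | w (i : Fin l) (h : i.val + 1 = l)

/-- Change of the parameters of a letter. -/
def GOEvenLetter.map {l : ℕ} {R S : Type*} (f : R → S) : GOEvenLetter l R → GOEvenLetter l S
  | x i j h t => x i j h (f t)
  | xUp i j h t => xUp i j h (f t)
  | xDown i j h t => xDown i j h (f t)
  | w i h => w i h

/-- The elementary matrices of `GO(2l, k)`. -/
def GOEvenLetter.toMatrix {l : ℕ} {k : Type*} [Field k] :
    GOEvenLetter l k → Matrix (EvenIdx l) (EvenIdx l) k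
  | x i j _ t => 1 + t • (e (.inl i) (.inl j) - e (.inr j) (.inr i))
  | xUp i j _ t => 1 + t • (e (.inl i) (.inr j) - e (.inl j) (.inr i))
  | xDown i j _ t => 1 + t • (e (.inr i) (.inl j) - e (.inr j) (.inl i))
  | w i _ => 1 - e (.inl i) (.inl i) - e (.inr i) (.inr i)
      - e (.inl i) (.inr i) - e (.inr i) (.inl i)

/-- Letters for `GO(2l+1, k)`. -/
inductive GOOddLetter (l : ℕ) (R : Type*)
  /-- `x_{i,j}(t)` -/
  | x (i j : Fin l) (h : i ≠ j) (t : R)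
  /-- `x_{i,-j}(t)` -/
  | xUp (i j : Fin l) (h : i < j) (t : R)
  /-- `x_{-i,j}(t)` -/
  | xDown (i j : Fin l) (h : i < j) (t : R)
  /-- `x_{i,0}(t)` -/
  | xZeroRight (i : Fin l) (t : R)
  /-- `x_{0,i}(t)` -/
  | xZeroLeft (i : Fin l) (t : R)
  /-- `w_l`, where `i` is the last index -/
  | w (i : Fin l) (h : i.val + 1 = l)

/-- Change of the parameters of a letter. -/
def GOOddLetter.map {l : ℕ} {R S : Type*} (f : R → S) : GOOddLetter l R → GOOddLetter l S
  | x i j h t => x i j h (f t)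
  | xUp i j h t => xUp i j h (f t)
  | xDown i j h t => xDown i j h (f t)
  | xZeroRight i t => xZeroRight i (f t)
  | xZeroLeft i t => xZeroLeft i (f t)
  | w i h => w i h

/-- The elementary matrices of `GO(2l+1, k)`. -/
def GOOddLetter.toMatrix {l : ℕ} {k : Type*} [Field k] :
    GOOddLetter l k → Matrix (OddIdx l) (OddIdx l) k
  | x i j _ t => 1 + t • (e (.inr (.inl i)) (.inr (.inl j)) - e (.inr (.inr j)) (.inr (.inr i)))
  | xUp i j _ t =>
      1 + t • (e (.inr (.inl i)) (.inr (.inr j)) - e (.inr (.inl j)) (.inr (.inr i)))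
  | xDown i j _ t =>
      1 + t • (e (.inr (.inr i)) (.inr (.inl j)) - e (.inr (.inr j)) (.inr (.inl i)))
  | xZeroRight i t =>
      1 + t • ((2 : k) • e (.inr (.inl i)) (.inl ()) - e (.inl ()) (.inr (.inr i)))
        - t ^ 2 • e (.inr (.inl i)) (.inr (.inr i))
  | xZeroLeft i t =>
      1 + t • (-((2 : k) • e (.inr (.inr i)) (.inl ())) + e (.inl ()) (.inr (.inl i)))
        - t ^ 2 • e (.inr (.inr i)) (.inr (.inl i))
  | w i _ => 1 - e (.inr (.inl i)) (.inr (.inl i)) - e (.inr (.inr i)) (.inr (.inr i))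
      - e (.inr (.inl i)) (.inr (.inr i)) - e (.inr (.inr i)) (.inr (.inl i))

/-- Letters for `GO⁻(2l, q)`, `l = m + 1`; here `i` and `j` are indices other than `±1`. -/
inductive GOTwistedLetter (m : ℕ) (R : Type*)
  /-- `x_{i,j}(t)` -/
  | x (i j : Fin m) (h : i ≠ j) (t : R)
  /-- `x_{i,-j}(t)` -/
  | xUp (i j : Fin m) (h : i < j) (t : R)
  /-- `x_{-i,j}(t)` -/
  | xDown (i j : Fin m) (h : i < j) (t : R)
  /-- `x_{i,1}(t)` -/
  | xOneRight (i : Fin m) (t : R)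
  /-- `x_{1,i}(t)` -/
  | xOneLeft (i : Fin m) (t : R)
  /-- `x_{i,-1}(t)` -/
  | xNegOneRight (i : Fin m) (t : R)
  /-- `x_{-1,i}(t)` -/
  | xNegOneLeft (i : Fin m) (t : R)
  /-- `w_i` -/
  | w (i : Fin m)
  /-- `x_1(t, s)` -/
  | x1 (t s : R)
  /-- `x_2` -/
  | x2

/-- Change of the parameters of a letter. -/
def GOTwistedLetter.map {m : ℕ} {R S : Type*} (f : R → S) :
    GOTwistedLetter m R → GOTwistedLetter m S
  | x i j h t => x i j h (f t)
  | xUp i j h t => xUp i j h (f t)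
  | xDown i j h t => xDown i j h (f t)
  | xOneRight i t => xOneRight i (f t)
  | xOneLeft i t => xOneLeft i (f t)
  | xNegOneRight i t => xNegOneRight i (f t)
  | xNegOneLeft i t => xNegOneLeft i (f t)
  | w i => w i
  | x1 t s => x1 (f t) (f s)
  | x2 => x2

/-- The elementary matrices of `GO⁻(2l, q)`, `l = m + 1`. The coefficients of the four families
`x_{i,±1}`, `x_{±1,i}` are those for which these matrices preserve `diag(1, ε) ⊕ (0, I; I, 0)`.
The matrix `x_1(t, s)` multiplies `diag(1, ε)` by `t ^ 2 + ε * s ^ 2`. -/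
def GOTwistedLetter.toMatrix {m : ℕ} {k : Type*} [Field k] (ε : k) :
    GOTwistedLetter m k → Matrix (TwIdx m) (TwIdx m) k
  | x i j _ t => 1 + t • (e (.inr (.inl i)) (.inr (.inl j)) - e (.inr (.inr j)) (.inr (.inr i)))
  | xUp i j _ t =>
      1 + t • (e (.inr (.inl i)) (.inr (.inr j)) - e (.inr (.inl j)) (.inr (.inr i)))
  | xDown i j _ t =>
      1 + t • (e (.inr (.inr i)) (.inr (.inl j)) - e (.inr (.inr j)) (.inr (.inl i)))
  | xOneRight i t =>
      1 + t • (-e (.inr (.inr i)) (.inl 0) + e (.inl 0) (.inr (.inl i)))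
        - (t ^ 2 / 2) • e (.inr (.inr i)) (.inr (.inl i))
  | xOneLeft i t =>
      1 + t • (e (.inr (.inl i)) (.inl 0) - e (.inl 0) (.inr (.inr i)))
        - (t ^ 2 / 2) • e (.inr (.inl i)) (.inr (.inr i))
  | xNegOneRight i t =>
      1 + t • (-(ε • e (.inr (.inr i)) (.inl 1)) + e (.inl 1) (.inr (.inl i)))
        - (ε * t ^ 2 / 2) • e (.inr (.inr i)) (.inr (.inl i))
  | xNegOneLeft i t =>
      1 + t • (ε • e (.inr (.inl i)) (.inl 1) - e (.inl 1) (.inr (.inr i)))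
        - (ε * t ^ 2 / 2) • e (.inr (.inl i)) (.inr (.inr i))
  | w i => 1 - e (.inr (.inl i)) (.inr (.inl i)) - e (.inr (.inr i)) (.inr (.inr i))
      - e (.inr (.inl i)) (.inr (.inr i)) - e (.inr (.inr i)) (.inr (.inl i))
  | x1 t s => 1 + (t - 1) • e (.inl 0) (.inl 0) - (t + 1) • e (.inl 1) (.inl 1)
      + s • (e (.inl 1) (.inl 0) + ε • e (.inl 0) (.inl 1))
  | x2 => 1 - (2 : k) • e (.inl 1) (.inl 1)

end Letters

/-! ## The diagonal matrices -/

/-- The entries `(1, …, 1, a, c, …, c, c a⁻¹)`, with `l` entries in each half (and with no entry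
at all when `l = 0`). -/
def diagEntries (l : ℕ) {k : Type*} [Field k] (a c : k) : EvenIdx l → k :=
  Sum.elim (fun i => if i.val + 1 = l then a else 1) (fun i => if i.val + 1 = l then c * a⁻¹ else c)

/-- `diag(1, …, 1, a, c, …, c, c a⁻¹)`. -/
def evenDiag (l : ℕ) {k : Type*} [Field k] (a c : k) : Matrix (EvenIdx l) (EvenIdx l) k :=
  diagonal (diagEntries l a c)

/-- `diag(α, 1, …, 1, a, c, …, c, c a⁻¹)`. -/
def oddDiag (l : ℕ) {k : Type*} [Field k] (α a c : k) : Matrix (OddIdx l) (OddIdx l) k :=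
  diagonal (Sum.elim (fun _ => α) (diagEntries l a c))

/-- `diag(1, 1, 1, …, 1, a, c, …, c, c a⁻¹)`. -/
def twistedDiag (m : ℕ) {k : Type*} [Field k] (a c : k) : Matrix (TwIdx m) (TwIdx m) k :=
  diagonal (Sum.elim (fun _ => 1) (diagEntries m a c))

/-! ## Elimination procedures

An elimination procedure is a finite decision tree that acts on a matrix by row operations. It
knows nothing about the field: it may test whether an arithmetic expression in the entries of the
current matrix is zero, and it may split off from the left an elementary matrix whose parameters
are such expressions. -/

/-- Arithmetic expressions in the entries of a matrix indexed by `ι` and in constants named by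
`π`. -/
inductive FieldExpr (ι π : Type)
  | entry (i j : ι)
  | const (p : π)
  | int (z : ℤ)
  | add (a b : FieldExpr ι π)
  | mul (a b : FieldExpr ι π)
  | inv (a : FieldExpr ι π)

/-- The value of an expression at a matrix `M`, where `c` gives the values of the constants. -/
def FieldExpr.eval {ι π : Type} {k : Type*} [Field k] (c : π → k) (M : Matrix ι ι k) :
    FieldExpr ι π → k
  | entry i j => M i j
  | const p => c p
  | int z => (z : k)
  | add a b => a.eval c M + b.eval c M
  | mul a b => a.eval c M * b.eval c M
  | inv a => (a.eval c M)⁻¹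

/-- Elimination procedures; `Γ` is a type of letters whose parameters are expressions. -/
inductive ElimTree (ι π Γ : Type)
  | halt
  | peel (x : Γ) (next : ElimTree ι π Γ)
  | ifZero (a : FieldExpr ι π) (yes no : ElimTree ι π Γ)

open Classical in
/-- Running an elimination procedure on a matrix `M`. A node `peel x` computes the letter `y` over
`k` given by `x` (via `sub`, which evaluates the parameters), writes `y` at the end of the word,
and replaces the current matrix `M` by `y⁻¹ * M`. The output is the word together with the matrix
that is left at the end. -/
noncomputable def ElimTree.run {ι π Γ : Type} [Fintype ι] {k : Type*} [Field k]
    {Λ : Type*} (sub : (FieldExpr ι π → k) → Γ → Λ) (mat : Λ → Matrix ι ι k) (c : π → k) :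
    ElimTree ι π Γ → Matrix ι ι k → List Λ × Matrix ι ι k
  | halt, M => ([], M)
  | peel x next, M =>
      let y := sub (FieldExpr.eval c M) x
      let r := next.run sub mat c ((mat y)⁻¹ * M)
      (y :: r.1, r.2)
  | ifZero a yes no, M =>
      if a.eval c M = 0 then yes.run sub mat c M else no.run sub mat c M

/-- Elimination procedures for `GSp(2l, -)`. -/
abbrev GSpTree (l : ℕ) : Type :=
  ElimTree (EvenIdx l) Empty (GSpLetter l (FieldExpr (EvenIdx l) Empty))

/-- Elimination procedures for `GO(2l, -)`. -/
abbrev GOEvenTree (l : ℕ) : Type :=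
  ElimTree (EvenIdx l) Empty (GOEvenLetter l (FieldExpr (EvenIdx l) Empty))

/-- Elimination procedures for `GO(2l+1, -)`. -/
abbrev GOOddTree (l : ℕ) : Type :=
  ElimTree (OddIdx l) Empty (GOOddLetter l (FieldExpr (OddIdx l) Empty))

/-- Elimination procedures for `GO⁻(2l, -)`, `l = m + 1`; the only constant is `ε`. -/
abbrev GOTwistedTree (m : ℕ) : Type :=
  ElimTree (TwIdx m) Unit (GOTwistedLetter m (FieldExpr (TwIdx m) Unit))

end SimilitudeWord

namespace SimilitudeWord

-- All four forms are monomial: an involution `opp` of the index set pairs `r` with `opp r`, with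
-- nonzero values `b r`. The indices `±i` form hyperbolic pairs; the fixed indices span a core of
-- dimension 0, 1 or 2. Every letter `x_{i,j}` with `i ≠ ±j` is then one Siegel transformation: it
-- adds a multiple of row `h` to row `r` and corrects row `opp h` so that the form is preserved.
-- Hence one elimination, stated for a `RootDatum`, serves all types; besides Siegel transformations
-- it needs only long root elements (symplectic case) or the reflection in the last pair (orthogonal
-- case).
--
-- Hyperbolic pairs are treated one at a time. Row operations make the entry of column `i` in row
-- `i` nonzero, turn it into 1 when a second hyperbolic row or a long root is available, and clear
-- the column; then column `-i` is cleared. The similitude equation does the rest. A column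
-- concentrated in one row forces the opposite row to be concentrated in the opposite column
-- (`row_eq_zero`), so finished pairs split off and are never touched again. The product of opposite
-- diagonal entries is the multiplier (`mul_eq`), which gives the shape of `D`. In the orthogonal
-- case nothing normalises the last pivot, and this is the parameter `λ`.
--
-- What remains is the core block: empty, a square root of the multiplier, or a similitude of
-- `diag(1, ε)`. The last is `x_1(t, s)` times `diag(1, ±1)`, where `(t, s)` is its first column.
--
-- The tree must not depend on the field. The predicate `Red` therefore asks for one tree valid over
-- all fields at once and keeps the length bound; it composes under sequencing, tests and loops. A
-- pair costs a number of letters linear in the size of the matrix, so the total is quadratic in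
-- `l`, well below the cubic bound.

universe u

/-! ## Composition of elimination procedures -/

/-- Run the second procedure after the first one. -/
def ElimTree.append {ι π Γ : Type} : ElimTree ι π Γ → ElimTree ι π Γ → ElimTree ι π Γ
  | halt, S => S
  | peel x next, S => peel x (next.append S)
  | ifZero a yes no, S => ifZero a (yes.append S) (no.append S)

theorem ElimTree.run_append {ι π Γ : Type} [Fintype ι] {k : Type*} [Field k]
    {Λ : Type*} (sub : (FieldExpr ι π → k) → Γ → Λ) (mat : Λ → Matrix ι ι k) (c : π → k)
    (T S : ElimTree ι π Γ) (M : Matrix ι ι k) :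
    (T.append S).run sub mat c M =
      ((T.run sub mat c M).1 ++ (S.run sub mat c (T.run sub mat c M).2).1,
        (S.run sub mat c (T.run sub mat c M).2).2) := by
  induction T generalizing M with
  | halt => simp [append, run]
  | peel x next ih => simp [append, run, ih]
  | ifZero a yes no ihy ihn =>
    simp only [append, run]
    split_ifs
    · exact ihy M
    · exact ihn M

/-- A field of characteristic not two with values of the constants and a multiplier. -/
structure Ctx (π : Type) where
  k : Type u
  [fld : Field k]
  two_ne : (2 : k) ≠ 0
  c : π → k
  μ : k
  μ_ne : μ ≠ 0

attribute [instance] Ctx.fld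

/-- Letters together with their matrices; `good` is a side condition on the letters of a word. -/
structure LetterSystem (ι π Γ : Type) where
  Letter : Type u → Type u
  subst : ∀ {k : Type u}, (FieldExpr ι π → k) → Γ → Letter k
  mat : ∀ K : Ctx.{u} π, Letter K.k → Matrix ι ι K.k
  good : ∀ K : Ctx.{u} π, Letter K.k → Prop

/-! ### Reductions between properties of matrices, uniform in the field -/

section Red

variable {ι π Γ : Type} [Fintype ι] [DecidableEq ι] (S : LetterSystem.{u} ι π Γ)

/-- There is an elimination procedure which takes every matrix with the property `P` to a matrix
with the property `Q` and writes at most `n` letters. -/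
def Red (P Q : ∀ K : Ctx.{u} π, Matrix ι ι K.k → Prop) (n : ℕ) : Prop :=
  ∃ T : ElimTree ι π Γ, ∀ (K : Ctx.{u} π) (M : Matrix ι ι K.k), P K M →
    ∃ (word : List (S.Letter K.k)) (M' : Matrix ι ι K.k),
      T.run S.subst (S.mat K) K.c M = (word, M') ∧ M = (word.map (S.mat K)).prod * M' ∧
        (∀ y ∈ word, S.good K y) ∧ word.length ≤ n ∧ Q K M'

variable {S} {P Q R : ∀ K : Ctx.{u} π, Matrix ι ι K.k → Prop} {n m : ℕ}

theorem Red.skip (h : ∀ K M, P K M → Q K M) : Red S P Q n :=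
  ⟨.halt, fun K M hP => ⟨[], M, by simp [ElimTree.run], by simp, by simp, by simp, h K M hP⟩⟩

theorem Red.seq (h₁ : Red S P Q n) (h₂ : Red S Q R m) : Red S P R (n + m) := by
  obtain ⟨T, hT⟩ := h₁
  obtain ⟨U, hU⟩ := h₂
  refine ⟨T.append U, fun K M hP => ?_⟩
  obtain ⟨w, M', hr, hM, hg, hl, hQ⟩ := hT K M hP
  obtain ⟨w', M'', hr', hM', hg', hl', hR⟩ := hU K M' hQ
  refine ⟨w ++ w', M'', ?_, ?_, ?_, ?_, hR⟩
  · simp [ElimTree.run_append, hr, hr']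
  · rw [hM, hM', List.map_append, List.prod_append, Matrix.mul_assoc]
  · intro y hy
    rcases List.mem_append.1 hy with hy | hy
    · exact hg y hy
    · exact hg' y hy
  · rw [List.length_append]; omega

theorem Red.mono (h : Red S P Q n) (hnm : n ≤ m) : Red S P Q m := by
  obtain ⟨T, hT⟩ := h
  refine ⟨T, fun K M hP => ?_⟩
  obtain ⟨w, M', hr, hM, hg, hl, hQ⟩ := hT K M hP
  exact ⟨w, M', hr, hM, hg, hl.trans hnm, hQ⟩

theorem Red.post (h : Red S P Q n) (hQ : ∀ K M, Q K M → R K M) : Red S P R n :=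
  h.seq (Red.skip (n := 0) hQ)

/-- A case distinction on the matrix has to be a node of the tree, but it writes no letter, so the
bound is that of the branches. Distinctions on indices alone are made while the tree is built. -/
theorem Red.ite (a : FieldExpr ι π)
    (h₁ : Red S (fun K M => P K M ∧ a.eval K.c M = 0) Q n)
    (h₂ : Red S (fun K M => P K M ∧ a.eval K.c M ≠ 0) Q n) : Red S P Q n := by
  obtain ⟨T, hT⟩ := h₁
  obtain ⟨U, hU⟩ := h₂
  refine ⟨.ifZero a T U, fun K M hP => ?_⟩
  by_cases h0 : a.eval K.c M = 0
  · simpa [ElimTree.run, h0] using hT K M ⟨hP, h0⟩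
  · simpa [ElimTree.run, h0] using hU K M ⟨hP, h0⟩

theorem Red.peel (x : Γ)
    (h : ∀ K M, P K M → S.good K (S.subst (FieldExpr.eval K.c M) x) ∧
      ∃ A, S.mat K (S.subst (FieldExpr.eval K.c M) x) * A = 1 ∧ Q K (A * M)) : Red S P Q 1 := by
  refine ⟨.peel x .halt, fun K M hP => ?_⟩
  obtain ⟨hg, A, hA, hQ⟩ := h K M hP
  refine ⟨[S.subst (FieldExpr.eval K.c M) x], A * M, ?_, ?_, ?_, ?_, hQ⟩
  · have h' : (S.mat K (S.subst (FieldExpr.eval K.c M) x))⁻¹ = A := Matrix.inv_eq_right_inv hA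
    simp only [ElimTree.run, ← h']
    -- The inverse in `ElimTree.run` is formed with classical decidability of equality on the
    -- indices.
    congr!
  · simp [← Matrix.mul_assoc, hA]
  · simpa using hg
  · simp

/-- The invariant `I s` speaks of the set `s` of indices already treated. The order of treatment is
immaterial, which allows induction on finite sets. -/
theorem Red.loop {α : Type} [DecidableEq α] [Fintype α]
    (I : Finset α → ∀ K : Ctx.{u} π, Matrix ι ι K.k → Prop)
    (h : ∀ r s, Red S (I s) (I (insert r s)) n) :
    Red S (I ∅) (I Finset.univ) (Fintype.card α * n) := by
  have key : ∀ s : Finset α, Red S (I ∅) (I s) (s.card * n) := by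
    intro s
    induction s using Finset.induction_on with
    | empty => exact Red.skip fun _ _ h => h
    | insert r s hr ih =>
      rw [Finset.card_insert_of_notMem hr, Nat.add_mul, Nat.one_mul]
      exact ih.seq (h r s)
  exact key Finset.univ

end Red

/-! ## Elementary isometries of a monomial form -/

section Isometries

variable {ι : Type} [Fintype ι] [DecidableEq ι] {k : Type u} [Field k]

/-- The form which pairs `r` with `opp r` to the value `b r`. -/
def monoForm (opp : ι → ι) (b : ι → k) : Matrix ι ι k :=
  of fun r s => if s = opp r then b r else 0

/-- The Siegel transformation which adds `t` times row `h` to row `r`. -/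
def siegel (opp : ι → ι) (b : ι → k) (h r : ι) (t : k) : Matrix ι ι k :=
  1 + single r h t - single (opp h) (opp r) (t * b r / b h)
    - single (opp h) h (if opp r = r then t ^ 2 * b r / (2 * b h) else 0)

/-- The symplectic transvection which adds `t` times row `h` to row `opp h`. -/
def longRoot (opp : ι → ι) (h : ι) (t : k) : Matrix ι ι k := 1 + single (opp h) h t

/-- The reflection which interchanges rows `h` and `opp h` up to sign. -/
def flipMatrix (opp : ι → ι) (h : ι) : Matrix ι ι k :=
  1 - single h h 1 - single (opp h) (opp h) 1 - single h (opp h) 1 - single (opp h) h 1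

theorem single_mul_apply' (i j : ι) (t : k) (M : Matrix ι ι k) (x c : ι) :
    (single i j t * M) x c = if x = i then t * M j c else 0 := by
  split_ifs with h
  · subst h; simp
  · rw [Matrix.single_mul_apply_of_ne _ _ _ _ _ h]

theorem siegel_mul_apply (opp : ι → ι) (b : ι → k) (h r : ι) (t : k) (M : Matrix ι ι k) (x c : ι) :
    (siegel opp b h r t * M) x c = M x c + (if x = r then t * M h c else 0)
      - (if x = opp h then t * b r / b h * M (opp r) c else 0)
      - (if x = opp h then (if opp r = r then t ^ 2 * b r / (2 * b h) else 0) * M h c else 0) := by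
  simp only [siegel, Matrix.sub_mul, Matrix.add_mul, Matrix.one_mul, Matrix.sub_apply,
    Matrix.add_apply, single_mul_apply']

theorem longRoot_mul_apply (opp : ι → ι) (h : ι) (t : k) (M : Matrix ι ι k) (x c : ι) :
    (longRoot opp h t * M) x c = M x c + (if x = opp h then t * M h c else 0) := by
  simp only [longRoot, Matrix.add_mul, Matrix.one_mul, Matrix.add_apply, single_mul_apply']

theorem flipMatrix_mul_apply (opp : ι → ι) (h : ι) (M : Matrix ι ι k) (x c : ι) :
    (flipMatrix (k := k) opp h * M) x c = M x c - (if x = h then M h c else 0)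
      - (if x = opp h then M (opp h) c else 0) - (if x = h then M (opp h) c else 0)
      - (if x = opp h then M h c else 0) := by
  simp only [flipMatrix, Matrix.sub_mul, Matrix.sub_apply, single_mul_apply', one_mul]

variable {opp : ι → ι} {b : ι → k}

theorem siegel_mul_siegel_neg (hopp : ∀ r, opp (opp r) = r) (hb : ∀ r, b r ≠ 0)
    (h2 : (2 : k) ≠ 0) {h r : ι} (hh : h ≠ opp h)
    (h1 : r ≠ h) (h3 : r ≠ opp h) (t : k) :
    siegel opp b h r t * siegel opp b h r (-t) = 1 := by
  have h4 : opp r ≠ opp h := fun H => h1 (by rw [← hopp r, H, hopp])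
  have hbh := hb h
  rw [← Matrix.mul_one (siegel opp b h r (-t))]
  ext x c
  simp only [siegel_mul_apply, if_neg h1.symm, if_neg hh, if_neg h4]
  by_cases hr : opp r = r
  · simp only [hr, if_true]
    by_cases hx : x = opp h
    · subst hx
      simp only [if_neg h3.symm, if_true]
      field_simp
      ring
    · simp only [if_neg hx]
      split_ifs <;> ring
  · simp only [if_neg hr]
    split_ifs <;> ring

theorem longRoot_mul_longRoot_neg {h : ι} (hh : h ≠ opp h) (t : k) :
    longRoot opp h t * longRoot opp h (-t) = 1 := by
  rw [← Matrix.mul_one (longRoot opp h (-t))]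
  ext x c
  simp only [longRoot_mul_apply, if_neg hh]
  split_ifs <;> ring

theorem flipMatrix_mul_self {h : ι} (hh : h ≠ opp h) :
    flipMatrix (k := k) opp h * flipMatrix opp h = 1 := by
  rw [← Matrix.mul_one (flipMatrix (k := k) opp h * flipMatrix opp h), Matrix.mul_assoc]
  ext x c
  simp only [flipMatrix_mul_apply, if_neg hh, if_neg hh.symm, if_true]
  by_cases h1 : x = h
  · subst h1; simp [hh]
  · by_cases h2 : x = opp h
    · subst h2; simp [h1]
    · simp [h1, h2]

theorem monoForm_mul_single (hopp : ∀ r, opp (opp r) = r) (i j : ι) (t : k) :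
    monoForm opp b * single i j t = single (opp i) j (b (opp i) * t) := by
  ext x y
  by_cases hy : y = j
  · subst hy
    by_cases hx : x = opp i
    · subst hx; simp [monoForm, hopp]
    · have : i ≠ opp x := fun H => hx (by rw [H, hopp])
      simp [monoForm, this, Ne.symm hx]
  · simp [hy, Ne.symm hy]

theorem single_mul_monoForm (i j : ι) (t : k) :
    single i j t * monoForm opp b = single i (opp j) (t * b j) := by
  ext x y
  rw [single_mul_apply']
  by_cases hx : x = i
  · subst hx
    by_cases hy : y = opp j
    · subst hy; simp [monoForm]
    · simp [monoForm, hy, Ne.symm hy]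
  · simp [hx, Ne.symm hx]

/-- The terms linear in `t` cancel by the choice of the coefficient at `(opp h, opp r)`. A quadratic
term arises only if `r` pairs with itself; it sits at `(h, h)` and equals twice the contribution of
the correction at `(opp h, h)`, hence the denominator 2. -/
theorem siegel_isometry (hopp : ∀ r, opp (opp r) = r) (hb : ∀ r, b r ≠ 0) (h2 : (2 : k) ≠ 0)
    (hsym : (∀ r, b (opp r) = b r) ∨ ∀ r, b (opp r) = -b r) {h r : ι} (hh : h ≠ opp h)
    (h1 : r ≠ h) (h3 : r ≠ opp h) (t : k) :
    (siegel opp b h r t)ᵀ * monoForm opp b * siegel opp b h r t = monoForm opp b := by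
  have h4 : opp r ≠ opp h := fun H => h1 (by rw [← hopp r, H, hopp])
  have h5 : opp r ≠ h := fun H => h3 (by rw [← H, hopp])
  have hbh := hb h
  have e1 : b (opp h) * (t * b r / b h) = t * b (opp r) := by
    rcases hsym with H | H <;> rw [H, H] <;> field_simp
  have e2 : t * b r / b h * b h = t * b r := by field_simp
  simp only [siegel, Matrix.transpose_sub, Matrix.transpose_add, Matrix.transpose_one,
    Matrix.transpose_single, Matrix.sub_mul, Matrix.add_mul, Matrix.one_mul, Matrix.mul_sub,
    Matrix.mul_add, Matrix.mul_one, monoForm_mul_single hopp, single_mul_monoForm, hopp]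
  by_cases hr : opp r = r
  · have hs : ∀ x, b (opp x) = b x := by
      rcases hsym with H | H
      · exact H
      -- A skew form in characteristic not two has no index paired with itself.
      · have := H r
        rw [hr, eq_neg_iff_add_eq_zero, ← two_mul] at this
        exact absurd this (mul_ne_zero h2 (hb r))
    have h7 : h ≠ r := h1.symm
    have h8 : r ≠ opp h := h3
    simp only [hr, if_true, hs] at e1 ⊢
    simp only [ne_eq, hh, not_false_eq_true, h7, h8, Matrix.single_mul_single_of_ne,
      Matrix.single_mul_single_same, sub_zero, e1, e2]
    ext x y
    simp only [Matrix.add_apply, Matrix.sub_apply, Matrix.single_apply, Matrix.zero_apply]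
    split_ifs <;> field_simp <;> ring
  · have h7 : h ≠ r := h1.symm
    simp only [hr, if_false, ne_eq, hh, h7, h4, not_false_eq_true,
      Matrix.single_mul_single_of_ne, sub_zero, add_zero, zero_mul,
      Matrix.single_zero, mul_zero]
    ext x y
    simp only [Matrix.add_apply, Matrix.sub_apply, Matrix.single_apply]
    rw [mul_comm (b h), e2, mul_comm _ (b (opp h)), e1, mul_comm t (b (opp r))]
    split_ifs <;> ring

/-- Both linear correction terms sit at `(h, h)` and cancel because the form is skew; the quadratic
term vanishes. -/
theorem longRoot_isometry (hopp : ∀ r, opp (opp r) = r) (hsym : ∀ r, b (opp r) = -b r) {h : ι}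
    (hh : h ≠ opp h) (t : k) :
    (longRoot opp h t)ᵀ * monoForm opp b * longRoot opp h t = monoForm opp b := by
  simp only [longRoot, Matrix.transpose_add, Matrix.transpose_one,
    Matrix.transpose_single, Matrix.add_mul, Matrix.one_mul,
    Matrix.mul_add, Matrix.mul_one, monoForm_mul_single hopp, single_mul_monoForm, hopp]
  rw [Matrix.single_mul_single_of_ne _ _ _ _ hh, add_zero, hsym, mul_neg, mul_comm t,
    ← Matrix.single_neg, add_assoc, neg_add_cancel, add_zero]

theorem flipMatrix_isometry (hopp : ∀ r, opp (opp r) = r) (hsym : ∀ r, b (opp r) = b r) {h : ι}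
    (hh : h ≠ opp h) :
    (flipMatrix (k := k) opp h)ᵀ * monoForm opp b * flipMatrix opp h = monoForm opp b := by
  have hh' := hh.symm
  simp only [flipMatrix, Matrix.transpose_sub, Matrix.transpose_one,
    Matrix.transpose_single, Matrix.sub_mul, Matrix.mul_sub,
    monoForm_mul_single hopp, single_mul_monoForm, hopp, hsym,
    Matrix.single_mul_single_same, one_mul, mul_one]
  simp [hh, hh']
  abel_nf

end Isometries

/-! ## Elimination for a monomial form -/

/-- A letter system on a space with a monomial form which has all Siegel transformations, and in
the symplectic case all long root elements, in the other case the last reflection. The indices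
fixed by `opp` span the core. -/
structure RootDatum (ι π Γ : Type) [Fintype ι] [DecidableEq ι] (l : ℕ) extends
    LetterSystem.{u} ι π Γ where
  opp : ι → ι
  opp_opp : ∀ r, opp (opp r) = r
  p : Fin l → ι
  p_inj : Function.Injective p
  p_ne : ∀ i j, p i ≠ opp (p j)
  symp : Prop
  b : ∀ K : Ctx.{u} π, ι → K.k
  b_symp : symp → ∀ K r, b K (opp r) = -b K r
  b_orth : ¬symp → ∀ K r, b K (opp r) = b K r
  exists_siegel : ∀ h r, h ≠ opp h → r ≠ h → r ≠ opp h → ∀ a : FieldExpr ι π, ∃ x : Γ,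
    ∀ (K : Ctx.{u} π) (M : Matrix ι ι K.k), (∀ r, b K r ≠ 0) →
      mat K (subst (FieldExpr.eval K.c M) x) = siegel opp (b K) h r (a.eval K.c M) ∧
        good K (subst (FieldExpr.eval K.c M) x)
  exists_longRoot : symp → ∀ h, h ≠ opp h → ∀ a : FieldExpr ι π, ∃ x : Γ,
    ∀ (K : Ctx.{u} π) (M : Matrix ι ι K.k),
      mat K (subst (FieldExpr.eval K.c M) x) = longRoot opp h (a.eval K.c M) ∧
        good K (subst (FieldExpr.eval K.c M) x)
  exists_flip : ¬symp → ∀ i : Fin l, i.val + 1 = l → ∃ x : Γ,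
    ∀ (K : Ctx.{u} π) (M : Matrix ι ι K.k),
      mat K (subst (FieldExpr.eval K.c M) x) = flipMatrix opp (p i) ∧
        good K (subst (FieldExpr.eval K.c M) x)

namespace RootDatum

variable {ι π Γ : Type} [Fintype ι] [DecidableEq ι] {l : ℕ} (S : RootDatum.{u} ι π Γ l)

/-- The index `r` does not occur among the first `i` hyperbolic pairs. -/
def Fresh (i : ℕ) (r : ι) : Prop := ∀ j : Fin l, j.val < i → r ≠ S.p j ∧ r ≠ S.opp (S.p j)

/-- The first `i` hyperbolic pairs of columns of the similitude `M` have been cleared. -/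
structure Stage (i : ℕ) (K : Ctx.{u} π) (M : Matrix ι ι K.k) : Prop where
  b_ne : ∀ r, S.b K r ≠ 0
  sim : Mᵀ * monoForm S.opp (S.b K) * M = K.μ • monoForm S.opp (S.b K)
  colP : ∀ j : Fin l, j.val < i → ∀ x, x ≠ S.p j → M x (S.p j) = 0
  colN : ∀ j : Fin l, j.val < i → ∀ x, x ≠ S.opp (S.p j) → M x (S.opp (S.p j)) = 0
  unit : ∀ j : Fin l, j.val < i → (j.val + 1 < l ∨ S.symp) → M (S.p j) (S.p j) = 1

theorem monoForm_pairing {k : Type*} [Field k] (opp : ι → ι) (b : ι → k) (M : Matrix ι ι k)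
    (c d : ι) : (Mᵀ * monoForm opp b * M) c d = ∑ r, b r * M r c * M (opp r) d := by
  rw [Matrix.mul_assoc, Matrix.mul_apply]
  refine Finset.sum_congr rfl fun r _ => ?_
  rw [Matrix.mul_apply, Finset.sum_eq_single (opp r)]
  · simp [monoForm]; ring
  · intro s _ hs; simp [monoForm, hs]
  · simp

variable {S} {i : ℕ} {K : Ctx.{u} π} {M : Matrix ι ι K.k}

theorem opp_inj {r s : ι} : S.opp r = S.opp s ↔ r = s :=
  ⟨fun h => by rw [← S.opp_opp r, h, S.opp_opp], fun h => by rw [h]⟩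

theorem opp_eq_iff {r s : ι} : S.opp r = s ↔ r = S.opp s :=
  ⟨fun h => by rw [← h, S.opp_opp], fun h => by rw [h, S.opp_opp]⟩

theorem b_sym (K : Ctx.{u} π) :
    (∀ r, S.b K (S.opp r) = S.b K r) ∨ ∀ r, S.b K (S.opp r) = -S.b K r := by
  by_cases h : S.symp
  · exact Or.inr (S.b_symp h K)
  · exact Or.inl (S.b_orth h K)

theorem Fresh.opp {r : ι} (h : S.Fresh i r) : S.Fresh i (S.opp r) := fun j hj =>
  ⟨fun e => (h j hj).2 (opp_eq_iff.1 e), fun e => (h j hj).1 (opp_inj.1 e)⟩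

theorem fresh_p {j : Fin l} (h : i ≤ j.val) : S.Fresh i (S.p j) := fun m hm =>
  ⟨fun e => by have := S.p_inj e; subst this; omega, S.p_ne j m⟩

/-! ### Relations among the entries of a partly cleared similitude -/

namespace Stage

theorem pairing (hM : S.Stage i K M) (c d : ι) :
    ∑ r, S.b K r * M r c * M (S.opp r) d = if d = S.opp c then K.μ * S.b K c else 0 := by
  rw [← monoForm_pairing, hM.sim]
  simp [monoForm]

/-- The pairing of a column concentrated in one row with another column. -/
theorem pairing_single (hM : S.Stage i K M) {c r : ι} (hc : ∀ x, x ≠ r → M x c = 0) (d : ι) :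
    S.b K r * M r c * M (S.opp r) d = if d = S.opp c then K.μ * S.b K c else 0 := by
  rw [← hM.pairing, Finset.sum_eq_single r]
  · intro x _ hx; simp [hc x hx]
  · simp

theorem exists_ne_zero (hM : S.Stage i K M) (c : ι) : ∃ r, M r c ≠ 0 := by
  by_contra! h
  have := hM.pairing c (S.opp c)
  simp [h] at this
  exact this.elim K.μ_ne (hM.b_ne c)

theorem ne_zero_of_single (hM : S.Stage i K M) {c r : ι} (hc : ∀ x, x ≠ r → M x c = 0) :
    M r c ≠ 0 := by
  obtain ⟨x, hx⟩ := hM.exists_ne_zero c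
  by_cases h : x = r
  · rwa [h] at hx
  · exact absurd (hc x h) hx

/-- If column `c` is concentrated in row `r`, then row `opp r` is concentrated in column
`opp c`. -/
theorem row_eq_zero (hM : S.Stage i K M) {c r : ι} (hc : ∀ x, x ≠ r → M x c = 0) {d : ι}
    (hd : d ≠ S.opp c) : M (S.opp r) d = 0 := by
  have := hM.pairing_single hc d
  rw [if_neg hd] at this
  exact (mul_eq_zero.1 this).resolve_left (mul_ne_zero (hM.b_ne r) (hM.ne_zero_of_single hc))

/-- Only one term survives when column `h` is paired with its opposite. This determines the second
half of the diagonal and makes the pivot of the opposite column nonzero. -/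
theorem mul_eq (hM : S.Stage i K M) {h : ι} (hc : ∀ x, x ≠ h → M x h = 0) :
    M h h * M (S.opp h) (S.opp h) = K.μ := by
  have := hM.pairing_single hc (S.opp h)
  rw [if_pos rfl, mul_assoc, mul_comm] at this
  exact mul_right_cancel₀ (hM.b_ne h) this

/-- The finished columns force the finished rows to vanish in all fresh columns. Hence an entry that
still has to be removed lies in a fresh row, and operations on fresh rows suffice. -/
theorem fresh_of_ne_zero (hM : S.Stage i K M) {r c : ι} (hc : S.Fresh i c) (h : M r c ≠ 0) :
    S.Fresh i r := by
  intro j hj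
  constructor
  · rintro rfl
    apply h
    have := hM.row_eq_zero (hM.colN j hj) (d := c)
    rw [S.opp_opp] at this
    exact this (hc j hj).1
  · rintro rfl
    exact h (hM.row_eq_zero (hM.colP j hj) (hc j hj).2)

/-- Here `A` is the letter and `A'` its inverse, the matrix that acts. The inverse of an isometry is
an isometry, so the multiplier is unchanged; `hfix` protects the finished columns. -/
theorem step (hM : S.Stage i K M) {A A' : Matrix ι ι K.k}
    (hA : Aᵀ * monoForm S.opp (S.b K) * A = monoForm S.opp (S.b K)) (hAA : A * A' = 1)
    (hfix : ∀ c, ¬S.Fresh i c → ∀ x, (A' * M) x c = M x c) : S.Stage i K (A' * M) := by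
  have hP : ∀ j : Fin l, j.val < i → ¬S.Fresh i (S.p j) := fun j hj h => (h j hj).1 rfl
  have hN : ∀ j : Fin l, j.val < i → ¬S.Fresh i (S.opp (S.p j)) := fun j hj h => (h j hj).2 rfl
  refine ⟨hM.b_ne, ?_, fun j hj x hx => ?_, fun j hj x hx => ?_, fun j hj hu => ?_⟩
  · have h1 : A'ᵀ * monoForm S.opp (S.b K) * A' = monoForm S.opp (S.b K) := by
      have h2 : A'ᵀ * Aᵀ = 1 := by rw [← Matrix.transpose_mul, hAA, Matrix.transpose_one]
      calc A'ᵀ * monoForm S.opp (S.b K) * A'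
          = A'ᵀ * (Aᵀ * monoForm S.opp (S.b K) * A) * A' := by rw [hA]
        _ = (A'ᵀ * Aᵀ) * monoForm S.opp (S.b K) * (A * A') := by simp only [Matrix.mul_assoc]
        _ = _ := by rw [h2, hAA, Matrix.one_mul, Matrix.mul_one]
    calc (A' * M)ᵀ * monoForm S.opp (S.b K) * (A' * M)
        = Mᵀ * (A'ᵀ * monoForm S.opp (S.b K) * A') * M := by
          simp only [Matrix.transpose_mul, Matrix.mul_assoc]
      _ = _ := by rw [h1, hM.sim]
  · rw [hfix _ (hP j hj)]; exact hM.colP j hj x hx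
  · rw [hfix _ (hN j hj)]; exact hM.colN j hj x hx
  · rw [hfix _ (hP j hj)]; exact hM.unit j hj hu

theorem eq_zero_of_not_fresh (hM : S.Stage i K M) {r c : ι} (hr : S.Fresh i r)
    (hc : ¬S.Fresh i c) : M r c = 0 := by
  simp only [Fresh, not_forall, not_and_or, not_not] at hc
  obtain ⟨j, hj, rfl | rfl⟩ := hc
  · exact hM.colP j hj r (hr j hj).1
  · exact hM.colN j hj r (hr j hj).2

/-! ### Row operations on fresh rows preserve the stage -/

theorem siegel (hM : S.Stage i K M) {h r : ι} (hh : h ≠ S.opp h) (h1 : r ≠ h)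
    (h2 : r ≠ S.opp h) (fh : S.Fresh i h) (fr : S.Fresh i r) (t : K.k) :
    S.Stage i K (siegel S.opp (S.b K) h r t * M) := by
  refine hM.step (siegel_isometry S.opp_opp hM.b_ne K.two_ne (b_sym K) hh h1 h2 (-t))
    (by simpa using siegel_mul_siegel_neg S.opp_opp hM.b_ne K.two_ne hh h1 h2 (-t))
    fun c hc x => ?_
  simp [siegel_mul_apply, hM.eq_zero_of_not_fresh fh hc, hM.eq_zero_of_not_fresh fr.opp hc]

theorem longRoot (hM : S.Stage i K M) (hs : S.symp) {h : ι} (hh : h ≠ S.opp h)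
    (fh : S.Fresh i h) (t : K.k) : S.Stage i K (longRoot S.opp h t * M) := by
  refine hM.step (longRoot_isometry S.opp_opp (S.b_symp hs K) hh (-t))
    (by simpa using longRoot_mul_longRoot_neg hh (-t)) fun c hc x => ?_
  simp [longRoot_mul_apply, hM.eq_zero_of_not_fresh fh hc]

theorem flip (hM : S.Stage i K M) (hs : ¬S.symp) {h : ι} (hh : h ≠ S.opp h)
    (fh : S.Fresh i h) : S.Stage i K (flipMatrix S.opp h * M) := by
  refine hM.step (flipMatrix_isometry S.opp_opp (S.b_orth hs K) hh)
    (flipMatrix_mul_self hh) fun c hc x => ?_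
  simp [flipMatrix_mul_apply, hM.eq_zero_of_not_fresh fh hc,
    hM.eq_zero_of_not_fresh fh.opp hc]

end Stage

/-! ### Peeling one letter -/

variable {P Q : ∀ K : Ctx.{u} π, Matrix ι ι K.k → Prop}

/-- A letter with parameter `a` is split off from the left, so its inverse, with parameter `-a`,
acts on the matrix. -/
theorem red_siegel {h r : ι} (hh : h ≠ S.opp h) (h1 : r ≠ h) (h2 : r ≠ S.opp h)
    (a : FieldExpr ι π) (hPQ : ∀ K M, P K M → (∀ r, S.b K r ≠ 0) ∧
      Q K (SimilitudeWord.siegel S.opp (S.b K) h r (-a.eval K.c M) * M)) :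
    Red S.toLetterSystem P Q 1 := by
  obtain ⟨x, hx⟩ := S.exists_siegel h r hh h1 h2 a
  refine Red.peel x fun K M hP => ?_
  obtain ⟨hb, hQ⟩ := hPQ K M hP
  obtain ⟨hm, hg⟩ := hx K M hb
  exact ⟨hg, _, by rw [hm, siegel_mul_siegel_neg S.opp_opp hb K.two_ne hh h1 h2], hQ⟩

theorem red_longRoot (hs : S.symp) {h : ι} (hh : h ≠ S.opp h)
    (a : FieldExpr ι π) (hPQ : ∀ K M, P K M →
      Q K (SimilitudeWord.longRoot S.opp h (-a.eval K.c M) * M)) :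
    Red S.toLetterSystem P Q 1 := by
  obtain ⟨x, hx⟩ := S.exists_longRoot hs h hh a
  refine Red.peel x fun K M hP => ?_
  obtain ⟨hm, hg⟩ := hx K M
  exact ⟨hg, _, by rw [hm, longRoot_mul_longRoot_neg hh], hPQ K M hP⟩

theorem red_flip (hs : ¬S.symp) {i : Fin l} (hi : i.val + 1 = l)
    (hPQ : ∀ K M, P K M → Q K (flipMatrix S.opp (S.p i) * M)) :
    Red S.toLetterSystem P Q 1 := by
  obtain ⟨x, hx⟩ := S.exists_flip hs i hi
  refine Red.peel x fun K M hP => ?_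
  obtain ⟨hm, hg⟩ := hx K M
  exact ⟨hg, _, by rw [hm, flipMatrix_mul_self (S.p_ne i i)], hPQ K M hP⟩

end RootDatum

namespace RootDatum

variable {ι π Γ : Type} [Fintype ι] [DecidableEq ι] {l : ℕ} {S : RootDatum.{u} ι π Γ l}

/-! ### Making the pivot nonzero -/

section Pivot

variable (i : Fin l)

/-- The correcting half of a Siegel transformation is used: adding row `opp (p i)` to row `opp r`
puts a nonzero multiple of row `r` into row `p i`. For a core index `r` the quadratic term could
cancel this, unless the entry in row `opp (p i)` is zero; hence the last condition. -/
theorem red_pivot_of_ne_zero {r : ι} (h1 : r ≠ S.p i) (h2 : r ≠ S.opp (S.p i)) :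
    Red S.toLetterSystem
      (fun K M => S.Stage i K M ∧ M (S.p i) (S.p i) = 0 ∧ M r (S.p i) ≠ 0 ∧
        (r ≠ S.opp r ∨ M (S.opp (S.p i)) (S.p i) = 0))
      (fun K M => S.Stage i K M ∧ M (S.p i) (S.p i) ≠ 0) 1 := by
  have hpp := S.opp_opp (S.p i)
  have hh : S.opp (S.p i) ≠ S.opp (S.opp (S.p i)) := by rw [hpp]; exact (S.p_ne i i).symm
  have h3 : S.opp r ≠ S.opp (S.p i) := fun H => h1 (opp_inj.1 H)
  have h4 : S.opp r ≠ S.opp (S.opp (S.p i)) := fun H => h2 (opp_inj.1 H)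
  refine red_siegel hh h3 h4 (.int 1) fun K M ⟨hM, h0, hr, hd⟩ => ⟨hM.b_ne, ?_, ?_⟩
  · exact hM.siegel hh h3 h4 (fresh_p le_rfl).opp
      (hM.fresh_of_ne_zero (fresh_p le_rfl) hr).opp _
  · have h4' : S.p i ≠ S.opp r := fun H => h4 (by rw [hpp, H])
    simp only [siegel_mul_apply, S.opp_opp, if_neg h4', if_true, h0, FieldExpr.eval]
    have hb := hM.b_ne (S.opp r)
    have hb' := hM.b_ne (S.opp (S.p i))
    have key : (if r = S.opp r then (-((1 : ℤ) : K.k)) ^ 2 * S.b K (S.opp r) /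
        (2 * S.b K (S.opp (S.p i))) else 0) * M (S.opp (S.p i)) (S.p i) = 0 := by
      rcases hd with hd | hd
      · rw [if_neg hd, zero_mul]
      · rw [hd, mul_zero]
    rw [key]
    simp [hb, hb', hr]

theorem red_pivot_noncore :
    Red S.toLetterSystem (fun K M => S.Stage i K M)
      (fun K M => S.Stage i K M ∧ (M (S.p i) (S.p i) ≠ 0 ∨ (M (S.p i) (S.p i) = 0 ∧
        ∀ r, r ≠ S.opp r → r ≠ S.p i → r ≠ S.opp (S.p i) → M r (S.p i) = 0)))
      (Fintype.card ι * 1) := by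
  have key := Red.loop (S := S.toLetterSystem) (n := 1) (α := ι)
    (fun s K M => S.Stage i K M ∧ (M (S.p i) (S.p i) ≠ 0 ∨ (M (S.p i) (S.p i) = 0 ∧
        ∀ r ∈ s, r ≠ S.opp r → r ≠ S.p i → r ≠ S.opp (S.p i) → M r (S.p i) = 0))) ?_
  · refine ((Red.skip (n := 0) ?_).seq (key.post ?_)).mono (by simp)
    · intro K M hM
      refine ⟨hM, ?_⟩
      by_cases h : M (S.p i) (S.p i) = 0
      · exact Or.inr ⟨h, by simp⟩
      · exact Or.inl h
    · rintro K M ⟨hM, h⟩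
      exact ⟨hM, h.imp id fun h => ⟨h.1, fun r => h.2 r (Finset.mem_univ r)⟩⟩
  · intro r s
    -- This depends on the index only, so it is decided while the tree is built.
    by_cases hr : r ≠ S.opp r ∧ r ≠ S.p i ∧ r ≠ S.opp (S.p i)
    · refine Red.ite (.entry (S.p i) (S.p i)) (Red.ite (.entry r (S.p i)) ?_ ?_) ?_
      · refine Red.skip ?_
        rintro K M ⟨⟨⟨hM, h⟩, h0⟩, hr0⟩
        refine ⟨hM, Or.inr ⟨h0, fun x hx => ?_⟩⟩
        rcases Finset.mem_insert.1 hx with rfl | hx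
        · exact fun _ _ _ => hr0
        · exact (h.resolve_left (not_not.2 h0)).2 x hx
      · refine ((Red.skip (n := 0) ?_).seq
          ((red_pivot_of_ne_zero i hr.2.1 hr.2.2).post ?_)).mono le_rfl
        · rintro K M ⟨⟨⟨hM, h⟩, h0⟩, hr0⟩
          exact ⟨hM, h0, hr0, Or.inl hr.1⟩
        · rintro K M ⟨hM, h⟩
          exact ⟨hM, Or.inl h⟩
      · refine Red.skip ?_
        rintro K M ⟨⟨hM, h⟩, h0⟩
        exact ⟨hM, Or.inl h0⟩
    · refine Red.skip ?_
      rintro K M ⟨hM, h⟩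
      refine ⟨hM, h.imp id fun h => ⟨h.1, fun x hx a b c => ?_⟩⟩
      rcases Finset.mem_insert.1 hx with rfl | hx
      · exact absurd ⟨a, b, c⟩ hr
      · exact h.2 x hx a b c

/-- A long root element or the last reflection moves the entry from row `opp (p i)` to row `p i`.
For an earlier pair in the orthogonal case neither is available, and the entry travels through the
last pair. -/
theorem red_pivot_opp :
    Red S.toLetterSystem
      (fun K M => S.Stage i K M ∧ M (S.p i) (S.p i) = 0 ∧ M (S.opp (S.p i)) (S.p i) ≠ 0 ∧
        ∀ r, r ≠ S.opp r → r ≠ S.p i → r ≠ S.opp (S.p i) → M r (S.p i) = 0)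
      (fun K M => S.Stage i K M ∧ M (S.p i) (S.p i) ≠ 0) 2 := by
  have hpp := S.opp_opp (S.p i)
  have hh : S.opp (S.p i) ≠ S.opp (S.opp (S.p i)) := by rw [hpp]; exact (S.p_ne i i).symm
  by_cases hs : S.symp
  · refine (red_longRoot hs hh (.int 1) ?_).mono (m := 2) (by norm_num)
    rintro K M ⟨hM, h0, h1, -⟩
    refine ⟨hM.longRoot hs hh (fresh_p le_rfl).opp _, ?_⟩
    simp [longRoot_mul_apply, hpp, h0, h1, FieldExpr.eval]
  · by_cases hi : i.val + 1 = l
    · refine (red_flip hs hi ?_).mono (m := 2) (by norm_num)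
      rintro K M ⟨hM, h0, h1, -⟩
      refine ⟨hM.flip hs (S.p_ne i i) (fresh_p le_rfl), ?_⟩
      simp [flipMatrix_mul_apply, S.p_ne, h0, h1]
    · have hil := i.2
      obtain ⟨j, hj⟩ : ∃ j : Fin l, j.val = l - 1 := ⟨⟨l - 1, by omega⟩, rfl⟩
      have hij : i.val < j.val := by omega
      have hpj : S.p j ≠ S.p i := fun h => by have := S.p_inj h; subst this; omega
      have h1 : S.opp (S.p j) ≠ S.opp (S.p i) := fun h => hpj (opp_inj.1 h)
      have h2 : S.opp (S.p j) ≠ S.p i := (S.p_ne i j).symm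
      -- First row `opp (p i)` is added to row `opp (p j)`. The pivot stays zero, since row `p j`
      -- vanishes in this column, and the new entry feeds the second letter.
      refine Red.seq (n := 1) (m := 1) ?_ (red_pivot_of_ne_zero i h2 h1)
      refine red_siegel hh h1 (by rwa [hpp]) (.int 1) fun K M ⟨hM, h0, hn, hz⟩ =>
        ⟨hM.b_ne, hM.siegel hh h1 (by rwa [hpp]) (fresh_p le_rfl).opp (fresh_p hij.le).opp _,
          ?_, ?_, Or.inl ?_⟩
      · have := hz (S.p j) (S.p_ne j j) hpj (S.p_ne j i)
        simp [siegel_mul_apply, hpp, S.opp_opp, S.p_ne, h0, this]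
      · have := hz (S.opp (S.p j)) (by rw [S.opp_opp]; exact (S.p_ne j j).symm) h2 h1
        simp [siegel_mul_apply, hpp, h2, this, hn, FieldExpr.eval]
      · rw [S.opp_opp]; exact (S.p_ne j j).symm

/-- A column supported on the core can occur: `diag(1, ε)` has isotropic vectors when `-ε` is a
square. The column of an invertible matrix is not zero, so some core row supplies the pivot. -/
theorem red_pivot_core :
    Red S.toLetterSystem
      (fun K M => S.Stage i K M ∧ (M (S.p i) (S.p i) ≠ 0 ∨ (M (S.p i) (S.p i) = 0 ∧
        ∀ r, r ≠ S.opp r → M r (S.p i) = 0)))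
      (fun K M => S.Stage i K M ∧ M (S.p i) (S.p i) ≠ 0) (Fintype.card ι * 1) := by
  have key := Red.loop (S := S.toLetterSystem) (n := 1) (α := ι)
    (fun s K M => S.Stage i K M ∧ (M (S.p i) (S.p i) ≠ 0 ∨ (M (S.p i) (S.p i) = 0 ∧
        (∀ r, r ≠ S.opp r → M r (S.p i) = 0) ∧ ∀ r ∈ s, M r (S.p i) = 0))) ?_
  · refine ((Red.skip (n := 0) ?_).seq (key.post ?_)).mono (by simp)
    · rintro K M ⟨hM, h⟩
      exact ⟨hM, h.imp id fun h => ⟨h.1, h.2, by simp⟩⟩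
    · rintro K M ⟨hM, h⟩
      obtain ⟨r, hr⟩ := hM.exists_ne_zero (S.p i)
      exact ⟨hM, h.resolve_right fun h => hr (h.2.2 r (Finset.mem_univ r))⟩
  · intro r s
    by_cases hr : r ≠ S.opp r
    · refine Red.skip ?_
      rintro K M ⟨hM, h⟩
      refine ⟨hM, h.imp id fun h => ⟨h.1, h.2.1, fun x hx => ?_⟩⟩
      rcases Finset.mem_insert.1 hx with rfl | hx
      · exact h.2.1 _ hr
      · exact h.2.2 x hx
    · rw [not_not] at hr
      have h1 : r ≠ S.p i := fun h => S.p_ne i i (by rwa [h] at hr)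
      have h2 : r ≠ S.opp (S.p i) := fun h => S.p_ne i i (by rw [h, S.opp_opp] at hr; exact hr.symm)
      refine Red.ite (.entry (S.p i) (S.p i)) (Red.ite (.entry r (S.p i)) ?_ ?_) ?_
      · refine Red.skip ?_
        rintro K M ⟨⟨⟨hM, h⟩, h0⟩, hr0⟩
        refine ⟨hM, Or.inr ⟨h0, (h.resolve_left (not_not.2 h0)).2.1, fun x hx => ?_⟩⟩
        rcases Finset.mem_insert.1 hx with rfl | hx
        · exact hr0
        · exact (h.resolve_left (not_not.2 h0)).2.2 x hx
      · refine ((Red.skip (n := 0) ?_).seq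
          ((red_pivot_of_ne_zero i h1 h2).post ?_)).mono le_rfl
        · rintro K M ⟨⟨⟨hM, h⟩, h0⟩, hr0⟩
          refine ⟨hM, h0, hr0, Or.inr ?_⟩
          refine (h.resolve_left (not_not.2 h0)).2.1 _ ?_
          rw [S.opp_opp]; exact (S.p_ne i i).symm
        · rintro K M ⟨hM, h⟩
          exact ⟨hM, Or.inl h⟩
      · refine Red.skip ?_
        rintro K M ⟨⟨hM, h⟩, h0⟩
        exact ⟨hM, Or.inl h0⟩

theorem red_pivot :
    Red S.toLetterSystem (fun K M => S.Stage i K M)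
      (fun K M => S.Stage i K M ∧ M (S.p i) (S.p i) ≠ 0)
      (Fintype.card ι * 1 + (2 + Fintype.card ι * 1)) := by
  refine (red_pivot_noncore i).seq (Red.seq ?_ (red_pivot_core i))
  refine Red.ite (.entry (S.p i) (S.p i))
    (Red.ite (.entry (S.opp (S.p i)) (S.p i)) (Red.skip ?_) ?_) (Red.skip ?_)
  · rintro K M ⟨⟨⟨hM, h⟩, h0⟩, h1⟩
    refine ⟨hM, Or.inr ⟨h0, fun r hr => ?_⟩⟩
    by_cases hp : r = S.p i
    · rw [hp]; exact h0
    · by_cases hn : r = S.opp (S.p i)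
      · rw [hn]; exact h1
      · exact (h.resolve_left (not_not.2 h0)).2 r hr hp hn
  · refine ((Red.skip (n := 0) ?_).seq ((red_pivot_opp i).post ?_)).mono le_rfl
    · rintro K M ⟨⟨⟨hM, h⟩, h0⟩, h1⟩
      exact ⟨hM, h0, h1, (h.resolve_left (not_not.2 h0)).2⟩
    · rintro K M ⟨hM, h⟩
      exact ⟨hM, Or.inl h⟩
  · rintro K M ⟨⟨hM, h⟩, h0⟩
    exact ⟨hM, Or.inl h0⟩

end Pivot

/-! ### Normalising the pivot -/

/-- With a second row at hand, two letters suffice: the pivot makes the entry in that row equal to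
1, and this 1 then corrects the pivot. The second row is `opp (p i)` in the symplectic case and the
last `p j` in the orthogonal case. -/
theorem red_normalise (i : Fin l) :
    Red S.toLetterSystem (fun K M => S.Stage i K M ∧ M (S.p i) (S.p i) ≠ 0)
      (fun K M => S.Stage i K M ∧ M (S.p i) (S.p i) ≠ 0 ∧
        (i.val + 1 < l ∨ S.symp → M (S.p i) (S.p i) = 1)) 2 := by
  have hpp := S.opp_opp (S.p i)
  have hh := S.p_ne i i
  have hh' : S.opp (S.p i) ≠ S.opp (S.opp (S.p i)) := by rw [hpp]; exact hh.symm
  by_cases hs : S.symp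
  · refine Red.seq (n := 1) (m := 1)
      (Q := fun K M => S.Stage i K M ∧ M (S.opp (S.p i)) (S.p i) = 1) ?_ ?_
    · refine red_longRoot hs hh (.mul (.add (.entry (S.opp (S.p i)) (S.p i)) (.int (-1)))
        (.inv (.entry (S.p i) (S.p i)))) ?_
      rintro K M ⟨hM, h0⟩
      refine ⟨hM.longRoot hs hh (fresh_p le_rfl) _, ?_⟩
      simp only [longRoot_mul_apply, FieldExpr.eval, if_true]
      field_simp
      push_cast
      ring
    · refine red_longRoot hs hh' (.add (.entry (S.p i) (S.p i)) (.int (-1))) ?_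
      rintro K M ⟨hM, h0⟩
      have : (longRoot S.opp (S.opp (S.p i)) (-FieldExpr.eval K.c M
          (.add (.entry (S.p i) (S.p i)) (.int (-1)))) * M) (S.p i) (S.p i) = 1 := by
        simp [longRoot_mul_apply, FieldExpr.eval, hpp, h0]
      exact ⟨hM.longRoot hs hh' (fresh_p le_rfl).opp _, by rw [this]; exact one_ne_zero,
        fun _ => this⟩
  · by_cases hi : i.val + 1 = l
    -- The last orthogonal pair offers no second row; its pivot remains as the parameter `λ`.
    · refine Red.skip fun K M h => ⟨h.1, h.2, fun h => ?_⟩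
      rcases h with h | h
      · omega
      · exact absurd h hs
    · have hil := i.2
      obtain ⟨j, hj⟩ : ∃ j : Fin l, j.val = l - 1 := ⟨⟨l - 1, by omega⟩, rfl⟩
      have hij : i.val < j.val := by omega
      have hpj : S.p j ≠ S.p i := fun h => by have := S.p_inj h; subst this; omega
      refine Red.seq (n := 1) (m := 1)
        (Q := fun K M => S.Stage i K M ∧ M (S.p j) (S.p i) = 1) ?_ ?_
      · refine red_siegel hh hpj (S.p_ne j i) (.mul (.add (.entry (S.p j) (S.p i)) (.int (-1)))
          (.inv (.entry (S.p i) (S.p i)))) ?_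
        rintro K M ⟨hM, h0⟩
        refine ⟨hM.b_ne, hM.siegel hh hpj (S.p_ne j i) (fresh_p le_rfl) (fresh_p hij.le) _, ?_⟩
        simp only [siegel_mul_apply, FieldExpr.eval, if_true, if_neg (S.p_ne j i)]
        field_simp
        push_cast
        ring
      · refine red_siegel (S.p_ne j j) hpj.symm (S.p_ne i j)
          (.add (.entry (S.p i) (S.p i)) (.int (-1))) ?_
        rintro K M ⟨hM, h0⟩
        have : (siegel S.opp (S.b K) (S.p j) (S.p i) (-FieldExpr.eval K.c M
            (.add (.entry (S.p i) (S.p i)) (.int (-1)))) * M) (S.p i) (S.p i) = 1 := by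
          simp [siegel_mul_apply, FieldExpr.eval, S.p_ne i j, h0]
        exact ⟨hM.b_ne, hM.siegel (S.p_ne j j) hpj.symm (S.p_ne i j) (fresh_p hij.le)
          (fresh_p le_rfl) _, by rw [this]; exact one_ne_zero, fun _ => this⟩

/-! ### Clearing a column -/

/-- Column `h` is to be cleared with the pivot in row `h`, where `h` is `S.p i` or its opposite,
and in the second case column `S.p i` is already cleared. -/
structure Clearing (S : RootDatum.{u} ι π Γ l) (i : Fin l) (h : ι) (K : Ctx.{u} π)
    (M : Matrix ι ι K.k) : Prop where
  stage : S.Stage i K M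
  pivot : M h h ≠ 0
  unit : i.val + 1 < l ∨ S.symp → M (S.p i) (S.p i) = 1
  colP : h ≠ S.p i → ∀ x, x ≠ S.p i → M x (S.p i) = 0

section Clear

variable {i : Fin l} {h : ι}

theorem ne_opp_of_eq (hi : h = S.p i ∨ h = S.opp (S.p i)) : h ≠ S.opp h := by
  rcases hi with rfl | rfl
  · exact S.p_ne i i
  · rw [S.opp_opp]; exact (S.p_ne i i).symm

theorem fresh_of_eq (hi : h = S.p i ∨ h = S.opp (S.p i)) : S.Fresh i h := by
  rcases hi with rfl | rfl
  · exact fresh_p le_rfl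
  · exact (fresh_p le_rfl).opp

theorem opp_eq_p_of_eq (hi : h = S.p i ∨ h = S.opp (S.p i)) (hp : h ≠ S.p i) :
    S.opp h = S.p i := by
  rw [hi.resolve_left hp, S.opp_opp]

theorem Clearing.siegel (hi : h = S.p i ∨ h = S.opp (S.p i)) {K : Ctx.{u} π}
    {M : Matrix ι ι K.k} (hM : S.Clearing i h K M) {r : ι} (h1 : r ≠ h) (h2 : r ≠ S.opp h)
    (fr : S.Fresh i r) (t : K.k) :
    S.Clearing i h K (SimilitudeWord.siegel S.opp (S.b K) h r t * M) := by
  have hh := ne_opp_of_eq hi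
  have hfix : h ≠ S.p i → ∀ x, (SimilitudeWord.siegel S.opp (S.b K) h r t * M) x (S.p i)
      = M x (S.p i) := by
    intro hp x
    have e1 := hM.colP hp h hp
    have e2 := hM.colP hp (S.opp r) fun e => by
      rw [← opp_eq_p_of_eq hi hp] at e
      exact h1 (opp_inj.1 e)
    simp [siegel_mul_apply, e1, e2]
  refine ⟨hM.stage.siegel hh h1 h2 (fresh_of_eq hi) fr t, ?_, fun hu => ?_, fun hp x hx => ?_⟩
  · simpa [siegel_mul_apply, h1.symm, hh] using hM.pivot
  · by_cases hp : h = S.p i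
    · subst hp
      simpa [siegel_mul_apply, h1.symm, hh] using hM.unit hu
    · rw [hfix hp]; exact hM.unit hu
  · rw [hfix hp]; exact hM.colP hp x hx

theorem Clearing.longRoot (hs : S.symp) (hi : h = S.p i ∨ h = S.opp (S.p i)) {K : Ctx.{u} π}
    {M : Matrix ι ι K.k} (hM : S.Clearing i h K M) (t : K.k) :
    S.Clearing i h K (SimilitudeWord.longRoot S.opp h t * M) := by
  have hh := ne_opp_of_eq hi
  have hfix : h ≠ S.p i → ∀ x, (SimilitudeWord.longRoot S.opp h t * M) x (S.p i)
      = M x (S.p i) := by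
    intro hp x
    simp [longRoot_mul_apply, hM.colP hp h hp]
  refine ⟨hM.stage.longRoot hs hh (fresh_of_eq hi) t, ?_, fun hu => ?_, fun hp x hx => ?_⟩
  · simpa [longRoot_mul_apply, hh] using hM.pivot
  · by_cases hp : h = S.p i
    · subst hp
      simpa [longRoot_mul_apply, hh] using hM.unit hu
    · rw [hfix hp]; exact hM.unit hu
  · rw [hfix hp]; exact hM.colP hp x hx

/-- Each Siegel transformation clears one row and disturbs only row `opp h`, so that row is left to
the end. There a long root element clears it, or, for a symmetric form, isotropy of the column shows
that it is already zero. -/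
theorem red_clear (hi : h = S.p i ∨ h = S.opp (S.p i)) :
    Red S.toLetterSystem (S.Clearing i h)
      (fun K M => S.Clearing i h K M ∧ ∀ x, x ≠ h → M x h = 0) (Fintype.card ι * 1 + 1) := by
  have hh := ne_opp_of_eq hi
  refine Red.seq (Q := fun K M => S.Clearing i h K M ∧
    ∀ x, x ≠ h → x ≠ S.opp h → M x h = 0) ?_ ?_
  · have key := Red.loop (S := S.toLetterSystem) (n := 1) (α := ι)
      (fun s K M => S.Clearing i h K M ∧ ∀ x ∈ s, x ≠ h → x ≠ S.opp h → M x h = 0) ?_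
    · refine ((Red.skip (n := 0) ?_).seq (key.post ?_)).mono (by simp)
      · exact fun K M hM => ⟨hM, by simp⟩
      · exact fun K M hM => ⟨hM.1, fun x => hM.2 x (Finset.mem_univ x)⟩
    · intro r s
      by_cases hr : r ≠ h ∧ r ≠ S.opp h
      · obtain ⟨h1, h2⟩ := hr
        refine Red.ite (.entry r h) (Red.skip ?_) (red_siegel hh h1 h2
          (.mul (.entry r h) (.inv (.entry h h))) ?_)
        · rintro K M ⟨⟨hM, hz⟩, h0⟩
          refine ⟨hM, fun x hx => ?_⟩
          rcases Finset.mem_insert.1 hx with rfl | hx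
          · exact fun _ _ => h0
          · exact hz x hx
        · rintro K M ⟨⟨hM, hz⟩, h0⟩
          refine ⟨hM.stage.b_ne, hM.siegel hi h1 h2
            (hM.stage.fresh_of_ne_zero (fresh_of_eq hi) h0) _, fun x hx hx1 hx2 => ?_⟩
          have hp := hM.pivot
          by_cases hxr : x = r
          · subst hxr
            simp [siegel_mul_apply, h2, FieldExpr.eval, hp]
          · simp [siegel_mul_apply, hx2, hxr,
              hz x ((Finset.mem_insert.1 hx).resolve_left hxr) hx1 hx2]
      · refine Red.skip fun K M hM => ⟨hM.1, fun x hx hx1 hx2 => ?_⟩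
        rcases Finset.mem_insert.1 hx with rfl | hx
        · exact absurd ⟨hx1, hx2⟩ hr
        · exact hM.2 x hx hx1 hx2
  · by_cases hs : S.symp
    · refine red_longRoot hs hh (.mul (.entry (S.opp h) h) (.inv (.entry h h))) ?_
      rintro K M ⟨hM, hz⟩
      refine ⟨hM.longRoot hs hi _, fun x hx => ?_⟩
      have hp := hM.pivot
      by_cases hx2 : x = S.opp h
      · simp [longRoot_mul_apply, hx2, FieldExpr.eval, hp]
      · simpa [longRoot_mul_apply, hx2] using hz x hx hx2
    · refine Red.skip ?_
      rintro K M ⟨hM, hz⟩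
      refine ⟨hM, fun x hx => ?_⟩
      by_cases hx2 : x = S.opp h
      · subst hx2
        -- Only rows `h` and `opp h` contribute, so the self-pairing is twice a nonzero multiple of
        -- the entry in row `opp h`.
        have e := hM.stage.pairing h h
        rw [if_neg hh, ← Finset.sum_subset (Finset.subset_univ {h, S.opp h}),
          Finset.sum_pair hh, S.opp_opp, S.b_orth hs] at e
        · have e' : (2 * S.b K h * M h h) * M (S.opp h) h = 0 := by linear_combination e
          exact (mul_eq_zero.1 e').resolve_left
            (mul_ne_zero (mul_ne_zero K.two_ne (hM.stage.b_ne h)) hM.pivot)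
        · intro y _ hy
          simp only [Finset.mem_insert, Finset.mem_singleton, not_or] at hy
          rw [hz y hy.1 hy.2, mul_zero, zero_mul]
      · exact hz x hx hx2

end Clear

/-! ### The whole elimination -/

theorem red_stage_succ (i : Fin l) :
    Red S.toLetterSystem (S.Stage i.val) (S.Stage (i.val + 1)) (4 * Fintype.card ι + 6) := by
  refine Red.mono ((red_pivot i).seq ((red_normalise i).seq (Red.seq
    ((Red.skip (n := 0) (Q := S.Clearing i (S.p i)) ?_).seq (red_clear (Or.inl rfl)))
    ((Red.skip (n := 0) (Q := S.Clearing i (S.opp (S.p i))) ?_).seq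
      ((red_clear (Or.inr rfl)).post ?_))))) (by omega)
  · rintro K M ⟨hM, h0, h1⟩
    exact ⟨hM, h0, h1, fun h => absurd rfl h⟩
  · rintro K M ⟨hM, hz⟩
    -- Once column `p i` is cleared, the opposite pivot is nonzero because the product of both is
    -- the multiplier.
    refine ⟨hM.stage, fun h => K.μ_ne ?_, hM.unit, fun _ => hz⟩
    rw [← hM.stage.mul_eq hz, h, mul_zero]
  · rintro K M ⟨hM, hz⟩
    have hlt : ∀ j : Fin l, j.val < i.val + 1 → j.val < i.val ∨ j = i := fun j hj => by
      rcases Nat.lt_succ_iff_lt_or_eq.1 hj with h | h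
      · exact Or.inl h
      · exact Or.inr (Fin.ext h)
    refine ⟨hM.stage.b_ne, hM.stage.sim, fun j hj => ?_, fun j hj => ?_, fun j hj hu => ?_⟩
    · rcases hlt j hj with h | rfl
      · exact hM.stage.colP j h
      · exact hM.colP (S.p_ne j j).symm
    · rcases hlt j hj with h | rfl
      · exact hM.stage.colN j h
      · exact hz
    · rcases hlt j hj with h | rfl
      · exact hM.stage.unit j h hu
      · exact hM.unit hu

theorem red_stage :
    Red S.toLetterSystem (S.Stage 0) (S.Stage l) (l * (4 * Fintype.card ι + 6)) := by
  have key : ∀ i, i ≤ l → Red S.toLetterSystem (S.Stage 0) (S.Stage i)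
      (i * (4 * Fintype.card ι + 6)) := by
    intro i
    induction i with
    | zero => exact fun _ => Red.skip fun _ _ h => h
    | succ i ih =>
      intro hi
      rw [Nat.add_mul, Nat.one_mul]
      exact (ih (by omega)).seq (red_stage_succ ⟨i, hi⟩)
  exact key l le_rfl

end RootDatum

/-! ## The four types of groups -/

theorem eq_evenDiag {l : ℕ} {k : Type*} [Field k] {M : Matrix (EvenIdx l) (EvenIdx l) k} {a c : k}
    (hP : ∀ j x, x ≠ .inl j → M x (.inl j) = 0) (hN : ∀ j x, x ≠ .inr j → M x (.inr j) = 0)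
    (hone : ∀ j : Fin l, j.val + 1 < l → M (.inl j) (.inl j) = 1)
    (hlast : ∀ j : Fin l, j.val + 1 = l → M (.inl j) (.inl j) = a) (ha : a ≠ 0)
    (hmul : ∀ j, M (.inl j) (.inl j) * M (.inr j) (.inr j) = c) : M = evenDiag l a c := by
  have hlt : ∀ j : Fin l, j.val + 1 ≠ l → j.val + 1 < l := fun j h => by have := j.2; omega
  ext x (j | j)
  · by_cases hx : x = .inl j
    · subst hx
      by_cases hj : j.val + 1 = l
      · simp [evenDiag, diagEntries, hj, hlast]
      · simp [evenDiag, diagEntries, hj, hone j (hlt j hj)]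
    · rw [hP j x hx, evenDiag, diagonal_apply_ne _ hx]
  · by_cases hx : x = .inr j
    · subst hx
      have := hmul j
      by_cases hj : j.val + 1 = l
      · rw [hlast j hj] at this
        simp only [evenDiag, diagEntries, diagonal_apply_eq, Sum.elim_inr, if_pos hj, ← this]
        field_simp
      · rw [hone j (hlt j hj), one_mul] at this
        simp [evenDiag, diagEntries, hj, this]
    · rw [hN j x hx, evenDiag, diagonal_apply_ne _ hx]

theorem single_neg' {ι k : Type*} [DecidableEq ι] [Field k] (i j : ι) (t : k) :
    single i j (-t) = -single i j t := (Matrix.single_neg i j t).symm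

theorem RootDatum.stage_zero {ι π Γ : Type} [Fintype ι] [DecidableEq ι] {l : ℕ}
    {S : RootDatum.{u} ι π Γ l} {K : Ctx.{u} π} {M : Matrix ι ι K.k} (hb : ∀ r, S.b K r ≠ 0)
    (hM : Mᵀ * monoForm S.opp (S.b K) * M = K.μ • monoForm S.opp (S.b K)) : S.Stage 0 K M :=
  ⟨hb, hM, fun _ h => absurd h (Nat.not_lt_zero _), fun _ h => absurd h (Nat.not_lt_zero _),
    fun _ h => absurd h (Nat.not_lt_zero _)⟩

/-! ### The symplectic groups -/

set_option linter.unusedSimpArgs false in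
/-- The letters of `GSp(2l, k)`. -/
def gspDatum (l : ℕ) :
    RootDatum.{u} (EvenIdx l) Empty (GSpLetter l (FieldExpr (EvenIdx l) Empty)) l where
  Letter := GSpLetter l
  subst f := GSpLetter.map f
  mat _ := GSpLetter.toMatrix
  good _ _ := True
  opp := Sum.swap
  opp_opp := Sum.swap_swap
  p := .inl
  p_inj := Sum.inl_injective
  p_ne _ _ := by simp
  symp := True
  b _ := Sum.elim (fun _ => 1) (fun _ => -1)
  b_symp := by rintro - K (r | r) <;> simp
  b_orth h := absurd trivial h
  exists_siegel := by
    rintro (j | j) (i | i) - h1 h2 a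
    · have h : i ≠ j := by simpa using h1
      refine ⟨.x i j h a, fun K M _ => ⟨?_, trivial⟩⟩
      simp [GSpLetter.map, GSpLetter.toMatrix, siegel, e, smul_single,
        FieldExpr.eval, neg_div, div_neg, single_neg', smul_sub, smul_add, h]
      abel
    · have h : i ≠ j := by simpa using h2
      rcases lt_or_gt_of_ne h with hij | hij
      · refine ⟨.xDown i j hij a, fun K M _ => ⟨?_, trivial⟩⟩
        simp [GSpLetter.map, GSpLetter.toMatrix, siegel, e, smul_single,
          FieldExpr.eval, neg_div, div_neg, single_neg', smul_sub, smul_add, h]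
        abel
      · refine ⟨.xDown j i hij a, fun K M _ => ⟨?_, trivial⟩⟩
        simp [GSpLetter.map, GSpLetter.toMatrix, siegel, e, smul_single,
          FieldExpr.eval, neg_div, div_neg, single_neg', smul_sub, smul_add, h]
        abel
    · have h : i ≠ j := by simpa using h2
      rcases lt_or_gt_of_ne h with hij | hij
      · refine ⟨.xUp i j hij a, fun K M _ => ⟨?_, trivial⟩⟩
        simp [GSpLetter.map, GSpLetter.toMatrix, siegel, e, smul_single,
          FieldExpr.eval, neg_div, div_neg, single_neg', smul_sub, smul_add, h]
        abel
      · refine ⟨.xUp j i hij a, fun K M _ => ⟨?_, trivial⟩⟩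
        simp [GSpLetter.map, GSpLetter.toMatrix, siegel, e, smul_single,
          FieldExpr.eval, neg_div, div_neg, single_neg', smul_sub, smul_add, h]
        abel
    · have h : i ≠ j := by simpa using h1
      -- Adding row `-j` to row `-i` is the correcting half of `x_{j,i}`, whence the sign.
      refine ⟨.x j i h.symm (.mul (.int (-1)) a), fun K M _ => ⟨?_, trivial⟩⟩
      simp [GSpLetter.map, GSpLetter.toMatrix, siegel, e, smul_single,
        FieldExpr.eval, neg_div, div_neg, single_neg', smul_sub, smul_add, h]
      abel
  exists_longRoot := by
    rintro - (j | j) - a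
    · exact ⟨.xDownDiag j a, fun K M => ⟨by
        simp [GSpLetter.map, GSpLetter.toMatrix, longRoot, e, smul_single], trivial⟩⟩
    · exact ⟨.xUpDiag j a, fun K M => ⟨by
        simp [GSpLetter.map, GSpLetter.toMatrix, longRoot, e, smul_single], trivial⟩⟩
  exists_flip h := absurd trivial h

theorem monoForm_gsp (l : ℕ) (K : Ctx.{u} Empty) :
    monoForm (gspDatum.{u} l).opp ((gspDatum.{u} l).b K) = symplecticForm l K.k := by
  ext (i | i) (j | j) <;> simp [gspDatum, monoForm, symplecticForm, one_apply, eq_comm, apply_ite]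

/-! ### The split even orthogonal groups -/

set_option linter.unusedSimpArgs false in
/-- The letters of `GO(2l, k)`. -/
def goEvenDatum (l : ℕ) :
    RootDatum.{u} (EvenIdx l) Empty (GOEvenLetter l (FieldExpr (EvenIdx l) Empty)) l where
  Letter := GOEvenLetter l
  subst f := GOEvenLetter.map f
  mat _ := GOEvenLetter.toMatrix
  good _ _ := True
  opp := Sum.swap
  opp_opp := Sum.swap_swap
  p := .inl
  p_inj := Sum.inl_injective
  p_ne _ _ := by simp
  symp := False
  b _ := fun _ => 1
  b_symp h := h.elim
  b_orth := by simp
  exists_siegel := by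
    rintro (j | j) (i | i) - h1 h2 a
    · have h : i ≠ j := by simpa using h1
      refine ⟨.x i j h a, fun K M _ => ⟨?_, trivial⟩⟩
      simp [GOEvenLetter.map, GOEvenLetter.toMatrix, siegel, e, smul_single,
        FieldExpr.eval, neg_div, div_neg, single_neg', smul_sub, smul_add, h]
      abel
    · have h : i ≠ j := by simpa using h2
      rcases lt_or_gt_of_ne h with hij | hij
      · refine ⟨.xDown i j hij a, fun K M _ => ⟨?_, trivial⟩⟩
        simp [GOEvenLetter.map, GOEvenLetter.toMatrix, siegel, e, smul_single,
          FieldExpr.eval, neg_div, div_neg, single_neg', smul_sub, smul_add, h]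
        abel
      -- The letters exist only for ordered indices; interchanging them changes the sign here,
      -- unlike in the symplectic case.
      · refine ⟨.xDown j i hij (.mul (.int (-1)) a), fun K M _ => ⟨?_, trivial⟩⟩
        simp [GOEvenLetter.map, GOEvenLetter.toMatrix, siegel, e, smul_single,
          FieldExpr.eval, neg_div, div_neg, single_neg', smul_sub, smul_add, h]
        abel
    · have h : i ≠ j := by simpa using h2
      rcases lt_or_gt_of_ne h with hij | hij
      · refine ⟨.xUp i j hij a, fun K M _ => ⟨?_, trivial⟩⟩
        simp [GOEvenLetter.map, GOEvenLetter.toMatrix, siegel, e, smul_single,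
          FieldExpr.eval, neg_div, div_neg, single_neg', smul_sub, smul_add, h]
        abel
      · refine ⟨.xUp j i hij (.mul (.int (-1)) a), fun K M _ => ⟨?_, trivial⟩⟩
        simp [GOEvenLetter.map, GOEvenLetter.toMatrix, siegel, e, smul_single,
          FieldExpr.eval, neg_div, div_neg, single_neg', smul_sub, smul_add, h]
        abel
    · have h : i ≠ j := by simpa using h1
      refine ⟨.x j i h.symm (.mul (.int (-1)) a), fun K M _ => ⟨?_, trivial⟩⟩
      simp [GOEvenLetter.map, GOEvenLetter.toMatrix, siegel, e, smul_single,
        FieldExpr.eval, neg_div, div_neg, single_neg', smul_sub, smul_add, h]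
      abel
  exists_longRoot h := h.elim
  exists_flip _ i hi := ⟨.w i hi, fun K M => ⟨by
    simp [GOEvenLetter.map, GOEvenLetter.toMatrix, flipMatrix, e], trivial⟩⟩

theorem monoForm_goEven (l : ℕ) (K : Ctx.{u} Empty) :
    monoForm (goEvenDatum.{u} l).opp ((goEvenDatum.{u} l).b K) = evenForm l K.k := by
  ext (i | i) (j | j) <;> simp [goEvenDatum, monoForm, evenForm, one_apply, eq_comm]

/-! ### The odd orthogonal groups -/

set_option linter.unusedSimpArgs false in
/-- The letters of `GO(2l+1, k)`. -/
def goOddDatum (l : ℕ) :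
    RootDatum.{u} (OddIdx l) Empty (GOOddLetter l (FieldExpr (OddIdx l) Empty)) l where
  Letter := GOOddLetter l
  subst f := GOOddLetter.map f
  mat _ := GOOddLetter.toMatrix
  good _ _ := True
  opp := Sum.map id Sum.swap
  opp_opp r := by rcases r with r | r | r <;> rfl
  p i := .inr (.inl i)
  p_inj i j h := by simpa using h
  p_ne _ _ := by simp
  symp := False
  b _ := Sum.elim (fun _ => 2) (fun _ => 1)
  b_symp h := h.elim
  b_orth := by rintro - K (r | r) <;> simp
  exists_siegel := by
    rintro (j | j | j) (i | i | i) h0 h1 h2 a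
    · exact absurd rfl h0
    · exact absurd rfl h0
    · exact absurd rfl h0
    · cases i
      refine ⟨.xZeroLeft j a, fun K M _ => ⟨?_, trivial⟩⟩
      have h := K.two_ne
      simp [GOOddLetter.map, GOOddLetter.toMatrix, siegel, e, smul_single,
        FieldExpr.eval, neg_div, div_neg, single_neg', smul_sub, smul_add, h]
      abel
    · have h : i ≠ j := by simpa using h1
      refine ⟨.x i j h a, fun K M _ => ⟨?_, trivial⟩⟩
      simp [GOOddLetter.map, GOOddLetter.toMatrix, siegel, e, smul_single,
        FieldExpr.eval, neg_div, div_neg, single_neg', smul_sub, smul_add, h]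
      abel
    · have h : i ≠ j := by simpa using h2
      rcases lt_or_gt_of_ne h with hij | hij
      · refine ⟨.xDown i j hij a, fun K M _ => ⟨?_, trivial⟩⟩
        simp [GOOddLetter.map, GOOddLetter.toMatrix, siegel, e, smul_single,
          FieldExpr.eval, neg_div, div_neg, single_neg', smul_sub, smul_add, h]
        abel
      · refine ⟨.xDown j i hij (.mul (.int (-1)) a), fun K M _ => ⟨?_, trivial⟩⟩
        simp [GOOddLetter.map, GOOddLetter.toMatrix, siegel, e, smul_single,
          FieldExpr.eval, neg_div, div_neg, single_neg', smul_sub, smul_add, h]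
        abel
    · cases i
      refine ⟨.xZeroRight j (.mul (.int (-1)) a), fun K M _ => ⟨?_, trivial⟩⟩
      have h := K.two_ne
      simp [GOOddLetter.map, GOOddLetter.toMatrix, siegel, e, smul_single,
        FieldExpr.eval, neg_div, div_neg, single_neg', smul_sub, smul_add, h]
      abel
    · have h : i ≠ j := by simpa using h2
      rcases lt_or_gt_of_ne h with hij | hij
      · refine ⟨.xUp i j hij a, fun K M _ => ⟨?_, trivial⟩⟩
        simp [GOOddLetter.map, GOOddLetter.toMatrix, siegel, e, smul_single,
          FieldExpr.eval, neg_div, div_neg, single_neg', smul_sub, smul_add, h]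
        abel
      · refine ⟨.xUp j i hij (.mul (.int (-1)) a), fun K M _ => ⟨?_, trivial⟩⟩
        simp [GOOddLetter.map, GOOddLetter.toMatrix, siegel, e, smul_single,
          FieldExpr.eval, neg_div, div_neg, single_neg', smul_sub, smul_add, h]
        abel
    · have h : i ≠ j := by simpa using h1
      refine ⟨.x j i h.symm (.mul (.int (-1)) a), fun K M _ => ⟨?_, trivial⟩⟩
      simp [GOOddLetter.map, GOOddLetter.toMatrix, siegel, e, smul_single,
        FieldExpr.eval, neg_div, div_neg, single_neg', smul_sub, smul_add, h]
      abel
  exists_longRoot h := h.elim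
  exists_flip _ i hi := ⟨.w i hi, fun K M => ⟨by
    simp [GOOddLetter.map, GOOddLetter.toMatrix, flipMatrix, e], trivial⟩⟩

theorem monoForm_goOdd (l : ℕ) (K : Ctx.{u} Empty) :
    monoForm (goOddDatum.{u} l).opp ((goOddDatum.{u} l).b K) = oddForm l K.k := by
  ext (i | i | i) (j | j | j) <;>
    simp [goOddDatum, monoForm, oddForm, evenForm, one_apply, eq_comm]

/-! ### The twisted orthogonal groups -/

set_option linter.unusedSimpArgs false in
/-- The letters of `GO⁻(2l, q)`, `l = m + 1`. -/
def goTwistedDatum (m : ℕ) :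
    RootDatum.{u} (TwIdx m) Unit (GOTwistedLetter m (FieldExpr (TwIdx m) Unit)) m where
  Letter := GOTwistedLetter m
  subst f := GOTwistedLetter.map f
  mat K := GOTwistedLetter.toMatrix (K.c ())
  good K y := ∀ t s, y = .x1 t s → t ^ 2 + K.c () * s ^ 2 = K.μ
  opp := Sum.map id Sum.swap
  opp_opp r := by rcases r with r | r | r <;> rfl
  p i := .inr (.inl i)
  p_inj i j h := by simpa using h
  p_ne _ _ := by simp
  symp := False
  b K := Sum.elim ![1, K.c ()] (fun _ => 1)
  b_symp h := h.elim
  b_orth := by rintro - K (r | r) <;> simp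
  exists_siegel := by
    rintro (j | j | j) (i | i | i) h0 h1 h2 a
    · exact absurd rfl h0
    · exact absurd rfl h0
    · exact absurd rfl h0
    · fin_cases i
      · refine ⟨.xOneRight j a, fun K M _ => ⟨?_, by rintro t s ⟨⟩⟩⟩
        simp [GOTwistedLetter.map, GOTwistedLetter.toMatrix, siegel, e, smul_single,
          FieldExpr.eval, neg_div, div_neg, single_neg', smul_sub, smul_add]
        abel
      · refine ⟨.xNegOneRight j a, fun K M _ => ⟨?_, by rintro t s ⟨⟩⟩⟩
        simp [GOTwistedLetter.map, GOTwistedLetter.toMatrix, siegel, e, smul_single,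
          FieldExpr.eval, neg_div, div_neg, single_neg', smul_sub, smul_add, mul_comm]
        abel
    · have h : i ≠ j := by simpa using h1
      refine ⟨.x i j h a, fun K M _ => ⟨?_, by rintro t s ⟨⟩⟩⟩
      simp [GOTwistedLetter.map, GOTwistedLetter.toMatrix, siegel, e, smul_single,
        FieldExpr.eval, neg_div, div_neg, single_neg', smul_sub, smul_add, h]
      abel
    · have h : i ≠ j := by simpa using h2
      rcases lt_or_gt_of_ne h with hij | hij
      · refine ⟨.xDown i j hij a, fun K M _ => ⟨?_, by rintro t s ⟨⟩⟩⟩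
        simp [GOTwistedLetter.map, GOTwistedLetter.toMatrix, siegel, e, smul_single,
          FieldExpr.eval, neg_div, div_neg, single_neg', smul_sub, smul_add, h]
        abel
      · refine ⟨.xDown j i hij (.mul (.int (-1)) a), fun K M _ => ⟨?_, by rintro t s ⟨⟩⟩⟩
        simp [GOTwistedLetter.map, GOTwistedLetter.toMatrix, siegel, e, smul_single,
          FieldExpr.eval, neg_div, div_neg, single_neg', smul_sub, smul_add, h]
        abel
    · fin_cases i
      · refine ⟨.xOneLeft j (.mul (.int (-1)) a), fun K M _ => ⟨?_, by rintro t s ⟨⟩⟩⟩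
        simp [GOTwistedLetter.map, GOTwistedLetter.toMatrix, siegel, e, smul_single,
          FieldExpr.eval, neg_div, div_neg, single_neg', smul_sub, smul_add]
        abel
      · refine ⟨.xNegOneLeft j (.mul (.int (-1)) a), fun K M _ => ⟨?_, by rintro t s ⟨⟩⟩⟩
        simp [GOTwistedLetter.map, GOTwistedLetter.toMatrix, siegel, e, smul_single,
          FieldExpr.eval, neg_div, div_neg, single_neg', smul_sub, smul_add, mul_comm]
        abel
    · have h : i ≠ j := by simpa using h2
      rcases lt_or_gt_of_ne h with hij | hij
      · refine ⟨.xUp i j hij a, fun K M _ => ⟨?_, by rintro t s ⟨⟩⟩⟩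
        simp [GOTwistedLetter.map, GOTwistedLetter.toMatrix, siegel, e, smul_single,
          FieldExpr.eval, neg_div, div_neg, single_neg', smul_sub, smul_add, h]
        abel
      · refine ⟨.xUp j i hij (.mul (.int (-1)) a), fun K M _ => ⟨?_, by rintro t s ⟨⟩⟩⟩
        simp [GOTwistedLetter.map, GOTwistedLetter.toMatrix, siegel, e, smul_single,
          FieldExpr.eval, neg_div, div_neg, single_neg', smul_sub, smul_add, h]
        abel
    · have h : i ≠ j := by simpa using h1
      refine ⟨.x j i h.symm (.mul (.int (-1)) a), fun K M _ => ⟨?_, by rintro t s ⟨⟩⟩⟩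
      simp [GOTwistedLetter.map, GOTwistedLetter.toMatrix, siegel, e, smul_single,
        FieldExpr.eval, neg_div, div_neg, single_neg', smul_sub, smul_add, h]
      abel
  exists_longRoot h := h.elim
  exists_flip _ i hi := ⟨.w i, fun K M => ⟨by
    simp [GOTwistedLetter.map, GOTwistedLetter.toMatrix, flipMatrix, e], by rintro t s ⟨⟩⟩⟩

theorem monoForm_goTwisted (m : ℕ) (K : Ctx.{u} Unit) :
    monoForm (goTwistedDatum.{u} m).opp ((goTwistedDatum.{u} m).b K)
      = twistedForm m (K.c ()) := by
  ext (i | i | i) (j | j | j) <;>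
    simp [goTwistedDatum, monoForm, twistedForm, evenForm, one_apply, diagonal_apply, eq_comm]

/-! ## Conclusion for each type -/

theorem exists_gspTree (l : ℕ) (hl : 1 ≤ l) : ∃ T : GSpTree l,
    ∀ (k : Type u) [Field k], (2 : k) ≠ 0 → ∀ g ∈ GSp l k,
      ∃ (c : kˣ) (word : List (GSpLetter l k)),
        HasMultiplier (symplecticForm l k) g c ∧
        T.run GSpLetter.map GSpLetter.toMatrix Empty.elim (g : Matrix _ _ k) =
          (word, evenDiag l 1 (c : k)) ∧
        (g : Matrix _ _ k) = (word.map GSpLetter.toMatrix).prod * evenDiag l 1 (c : k) ∧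
        word.length ≤ 24 * l ^ 3 := by
  obtain ⟨T, hT⟩ := (RootDatum.red_stage (S := gspDatum.{u} l)).post
    (R := fun K M => M = evenDiag l 1 K.μ) fun K M hM =>
      eq_evenDiag (fun j => hM.colP j j.2) (fun j => hM.colN j j.2)
        (fun j _ => hM.unit j j.2 (Or.inr trivial)) (fun j _ => hM.unit j j.2 (Or.inr trivial))
        one_ne_zero (fun j => hM.mul_eq (hM.colP j j.2))
  refine ⟨T, fun k _ h2 g hg => ?_⟩
  obtain ⟨c, hc⟩ := hg
  let K : Ctx.{u} Empty := ⟨k, h2, Empty.elim, c, c.ne_zero⟩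
  obtain ⟨w, M', hr, hM, -, hlen, rfl⟩ := hT K (g : Matrix _ _ k) (RootDatum.stage_zero
    (by rintro (r | r) <;> simp [gspDatum]) (by rw [monoForm_gsp]; exact hc))
  refine ⟨c, w, hc, hr, hM, hlen.trans ?_⟩
  simp only [Fintype.card_sum, Fintype.card_fin]
  -- The count is `l * (8 * l + 6)`, which is at most `14 * l ^ 2`.
  nlinarith [Nat.pow_le_pow_left hl 2, Nat.mul_le_mul_left (l ^ 2) hl]

theorem exists_goEvenTree (l : ℕ) (hl : 1 ≤ l) : ∃ T : GOEvenTree l,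
    ∀ (k : Type u) [Field k], (2 : k) ≠ 0 → ∀ g ∈ GOEven l k,
      ∃ (a c : kˣ) (word : List (GOEvenLetter l k)),
        HasMultiplier (evenForm l k) g c ∧
        T.run GOEvenLetter.map GOEvenLetter.toMatrix Empty.elim (g : Matrix _ _ k) =
          (word, evenDiag l (a : k) (c : k)) ∧
        (g : Matrix _ _ k) =
          (word.map GOEvenLetter.toMatrix).prod * evenDiag l (a : k) (c : k) ∧
        word.length ≤ 24 * l ^ 3 := by
  obtain ⟨T, hT⟩ := (RootDatum.red_stage (S := goEvenDatum.{u} l)).post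
    (R := fun K M => ∃ a, a ≠ 0 ∧ M = evenDiag l a K.μ) fun K M hM => by
      have hne : M (.inl ⟨l - 1, by omega⟩) (.inl ⟨l - 1, by omega⟩) ≠ 0 :=
        hM.ne_zero_of_single (hM.colP ⟨l - 1, by omega⟩ (by simp only; omega))
      refine ⟨_, hne, eq_evenDiag (fun j => hM.colP j j.2) (fun j => hM.colN j j.2)
        (fun j hj => hM.unit j j.2 (Or.inl hj)) (fun j hj => ?_) hne
        (fun j => hM.mul_eq (hM.colP j j.2))⟩
      have : j = ⟨l - 1, by omega⟩ := Fin.ext (by simp only; omega)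
      rw [← this]
  refine ⟨T, fun k _ h2 g hg => ?_⟩
  obtain ⟨c, hc⟩ := hg
  let K : Ctx.{u} Empty := ⟨k, h2, Empty.elim, c, c.ne_zero⟩
  obtain ⟨w, M', hr, hM, -, hlen, a, ha, rfl⟩ := hT K (g : Matrix _ _ k) (RootDatum.stage_zero
    (fun _ => one_ne_zero) (by rw [monoForm_goEven]; exact hc))
  refine ⟨Units.mk0 a ha, c, w, hc, hr, hM, hlen.trans ?_⟩
  simp only [Fintype.card_sum, Fintype.card_fin]
  nlinarith [Nat.pow_le_pow_left hl 2, Nat.mul_le_mul_left (l ^ 2) hl]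

/-- At the end of the elimination only the core block is left. -/
theorem RootDatum.Stage.eq_fromBlocks {κ π Γ : Type} [Fintype κ] [DecidableEq κ] {l : ℕ}
    {S : RootDatum.{u} (κ ⊕ EvenIdx l) π Γ l} (hp : ∀ i, S.p i = .inr (.inl i))
    (ho : S.opp = Sum.map id Sum.swap) {K : Ctx.{u} π}
    {M : Matrix (κ ⊕ EvenIdx l) (κ ⊕ EvenIdx l) K.k} (hM : S.Stage l K M) :
    ∃ a, a ≠ 0 ∧ M = fromBlocks M.toBlocks₁₁ 0 0 (evenDiag l a K.μ) := by
  have hon : ∀ i, S.opp (S.p i) = .inr (.inr i) := fun i => by rw [ho, hp]; rfl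
  have hP : ∀ j x, x ≠ .inr (.inl j) → M x (.inr (.inl j)) = 0 := fun j => by
    have := hM.colP j j.2; rwa [hp] at this
  have hN : ∀ j x, x ≠ .inr (.inr j) → M x (.inr (.inr j)) = 0 := fun j => by
    have := hM.colN j j.2; rwa [hon] at this
  have hdiag : ∀ j, M (.inr (.inl j)) (.inr (.inl j)) ≠ 0 := fun j =>
    hM.ne_zero_of_single (hP j)
  obtain ⟨a, ha, hlast⟩ : ∃ a, a ≠ 0 ∧ ∀ j : Fin l, j.val + 1 = l →
      M (.inr (.inl j)) (.inr (.inl j)) = a := by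
    by_cases h : ∃ j : Fin l, j.val + 1 = l
    · obtain ⟨j, hj⟩ := h
      refine ⟨_, hdiag j, fun i hi => ?_⟩
      have : i = j := Fin.ext (by omega)
      rw [this]
    -- Without hyperbolic pairs (`GO⁻(2, q)`) there is no last entry and any nonzero value serves.
    · exact ⟨1, one_ne_zero, fun j hj => absurd ⟨j, hj⟩ h⟩
  refine ⟨a, ha, ?_⟩
  have h22 : M.toBlocks₂₂ = evenDiag l a K.μ := by
    refine eq_evenDiag (fun j x hx => hP j _ (by simpa using hx))
      (fun j x hx => hN j _ (by simpa using hx)) (fun j hj => ?_) hlast ha (fun j => ?_)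
    · have := hM.unit j j.2 (Or.inl hj)
      rwa [hp] at this
    · have := hM.mul_eq (hM.colP j j.2)
      rwa [hon, hp] at this
  have h12 : M.toBlocks₁₂ = 0 := by
    ext x (j | j)
    · exact hP j _ (by simp)
    · exact hN j _ (by simp)
  have h21 : M.toBlocks₂₁ = 0 := by
    ext (j | j) x
    · have := hM.row_eq_zero (hM.colN j j.2) (d := .inl x)
      rw [S.opp_opp, hp] at this
      exact this (by simp)
    · have := hM.row_eq_zero (hM.colP j j.2) (d := .inl x)
      rw [hon] at this
      exact this (by simp)
  rw [← h22, ← h12, ← h21, fromBlocks_toBlocks]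

theorem exists_goOddTree (l : ℕ) (hl : 1 ≤ l) : ∃ T : GOOddTree l,
    ∀ (k : Type u) [Field k], (2 : k) ≠ 0 → ∀ g ∈ GOOdd l k,
      ∃ (α a c : kˣ) (word : List (GOOddLetter l k)),
        HasMultiplier (oddForm l k) g c ∧
        α ^ 2 = c ∧
        T.run GOOddLetter.map GOOddLetter.toMatrix Empty.elim (g : Matrix _ _ k) =
          (word, oddDiag l (α : k) (a : k) (c : k)) ∧
        (g : Matrix _ _ k) =
          (word.map GOOddLetter.toMatrix).prod * oddDiag l (α : k) (a : k) (c : k) ∧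
        word.length ≤ 24 * l ^ 3 := by
  obtain ⟨T, hT⟩ := (RootDatum.red_stage (S := goOddDatum.{u} l)).post
    (R := fun K M => ∃ α a, a ≠ 0 ∧ α ^ 2 = K.μ ∧ M = oddDiag l α a K.μ) fun K M hM => by
      obtain ⟨a, ha, hMa⟩ := hM.eq_fromBlocks (fun _ => rfl) rfl
      refine ⟨M (.inl ()) (.inl ()), a, ha, ?_, ?_⟩
      -- The self-pairing of the core column reads `2 * α ^ 2 = 2 * μ`.
      · have h := hM.pairing (.inl ()) (.inl ())
        have hz : ∀ i, M (.inr i) (.inl ()) = 0 := fun i => by rw [hMa]; rfl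
        simp only [Fintype.sum_sum_type, hz, mul_zero, zero_mul, Finset.sum_const_zero,
          add_zero] at h
        refine mul_left_cancel₀ K.two_ne ?_
        simp [goOddDatum] at h
        linear_combination h
      · conv_lhs => rw [hMa]
        rw [oddDiag, evenDiag, ← fromBlocks_diagonal]
        congr 1
  refine ⟨T, fun k _ h2 g hg => ?_⟩
  obtain ⟨c, hc⟩ := hg
  let K : Ctx.{u} Empty := ⟨k, h2, Empty.elim, c, c.ne_zero⟩
  obtain ⟨w, M', hr, hM, -, hlen, α, a, ha, hα, rfl⟩ := hT K (g : Matrix _ _ k)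
    (RootDatum.stage_zero (by rintro (r | r) <;> simp [goOddDatum, K, h2])
      (by rw [monoForm_goOdd]; exact hc))
  have hα' : α ≠ 0 := fun h => c.ne_zero (by rw [← show α ^ 2 = (c : k) from hα, h]; simp)
  refine ⟨Units.mk0 α hα', Units.mk0 a ha, c, w, hc, Units.ext hα, hr, hM, hlen.trans ?_⟩
  simp only [Fintype.card_sum, Fintype.card_fin, Fintype.card_unit]
  nlinarith [Nat.pow_le_pow_left hl 2, Nat.mul_le_mul_left (l ^ 2) hl]

theorem twistedDiag_eq (m : ℕ) {k : Type*} [Field k] (a c : k) :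
    twistedDiag m a c = fromBlocks !![1, 0; 0, 1] 0 0 (evenDiag m a c) := by
  rw [twistedDiag, evenDiag, ← fromBlocks_diagonal]
  congr 1
  ext i j
  fin_cases i <;> fin_cases j <;> rfl

/-- Splitting off the core block in the twisted case. -/
theorem red_twisted_core (m : ℕ) :
    Red (goTwistedDatum.{u} m).toLetterSystem ((goTwistedDatum.{u} m).Stage m)
      (fun K M => ∃ a, a ≠ 0 ∧ M = twistedDiag m a K.μ) 2 := by
  refine Red.seq (n := 1) (m := 1) (Q := fun K M => ∃ a d, a ≠ 0 ∧ (d = 1 ∨ d = -1) ∧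
    M = fromBlocks !![1, 0; 0, d] 0 0 (evenDiag m a K.μ)) ?_ ?_
  -- The letter `x_1(t, s)` has the same first column and the same multiplier as the core block, so
  -- the quotient is an isometry fixing the first basis vector, hence `diag(1, ±1)`. Its core block
  -- squares to `t ^ 2 + ε * s ^ 2 = μ`, which gives the inverse.
  · refine Red.peel (.x1 (.entry (.inl 0) (.inl 0)) (.entry (.inl 1) (.inl 0))) ?_
    intro K M hM
    obtain ⟨a, ha, hMa⟩ := hM.eq_fromBlocks (fun _ => rfl) rfl
    have hz : ∀ i j, M (.inr i) (.inl j) = 0 := fun i j => by rw [hMa]; rfl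
    have hp : ∀ i j : Fin 2, M (.inl 0) (.inl i) * M (.inl 0) (.inl j) +
        K.c () * M (.inl 1) (.inl i) * M (.inl 1) (.inl j) =
        if j = i then K.μ * ![1, K.c ()] i else 0 := by
      intro i j
      have h := hM.pairing (.inl i) (.inl j)
      simp only [Fintype.sum_sum_type, hz, mul_zero, zero_mul, Finset.sum_const_zero,
        add_zero] at h
      simpa [goTwistedDatum, Fin.sum_univ_two] using h
    have h00 := hp 0 0
    have h01 := hp 0 1
    have h11 := hp 1 1
    simp at h00 h01 h11
    have hε : K.c () ≠ 0 := by simpa [goTwistedDatum] using hM.b_ne (.inl 1)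
    set t := M (.inl 0) (.inl 0) with ht
    set s := M (.inl 1) (.inl 0) with hs
    set b := M (.inl 0) (.inl 1) with hb
    set d := M (.inl 1) (.inl 1) with hd
    have hμ := K.μ_ne
    have hcore : M.toBlocks₁₁ = !![t, b; s, d] := by
      ext i j; fin_cases i <;> fin_cases j <;> rfl
    have hx : GOTwistedLetter.toMatrix (m := m) (K.c ()) (.x1 t s) =
        fromBlocks !![t, K.c () * s; s, -t] 0 0 1 := by
      ext (i | i) (j | j)
      · fin_cases i <;> fin_cases j <;>
          simp [GOTwistedLetter.toMatrix, e, mul_comm]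
      · simp [GOTwistedLetter.toMatrix, e]
      · simp [GOTwistedLetter.toMatrix, e]
      · simp [GOTwistedLetter.toMatrix, e, Matrix.one_apply]
    refine ⟨?_, fromBlocks !![t / K.μ, K.c () * s / K.μ; s / K.μ, -t / K.μ] 0 0 1, ?_,
      a, (s * b - t * d) / K.μ, ha, ?_, ?_⟩
    · rintro t' s' ⟨⟩
      change t ^ 2 + K.c () * s ^ 2 = K.μ
      linear_combination h00
    · change GOTwistedLetter.toMatrix (m := m) (K.c ()) (.x1 t s) *
        fromBlocks !![t / K.μ, K.c () * s / K.μ; s / K.μ, -t / K.μ] 0 0 1 = 1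
      rw [hx, fromBlocks_multiply]
      refine Eq.trans ?_ fromBlocks_one
      congr 1
      · ext i j
        fin_cases i <;> fin_cases j <;> simp <;> field_simp <;>
          first
          | linear_combination h00
          | ring1
      all_goals simp
    · have hsq : ((s * b - t * d) / K.μ) ^ 2 = 1 := by
        rw [div_pow, div_eq_one_iff_eq (pow_ne_zero 2 hμ)]
        refine mul_left_cancel₀ hε ?_
        -- Brahmagupta's identity: `(t² + εs²)(b² + εd²) = (tb + εsd)² + ε(sb - td)²`, where the
        -- columns are orthogonal.
        linear_combination (b * b + K.c () * d * d) * h00 + K.μ * h11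
          - (t * b + K.c () * s * d) * h01
      exact mul_self_eq_one_iff.1 (by rw [← sq]; exact hsq)
    · conv_lhs => rw [hMa, hcore]
      rw [fromBlocks_multiply]
      congr 1
      · ext i j
        fin_cases i <;> fin_cases j <;> simp <;> field_simp <;>
          first
          | linear_combination h00
          | linear_combination h01
          | ring1
      all_goals simp
  -- The remaining sign is read off by testing `d - 1`, and `x_2` removes it if it is `-1`.
  · refine Red.ite (.add (.entry (.inl 1) (.inl 1)) (.int (-1))) (Red.skip ?_) (Red.peel .x2 ?_)
    · rintro K M ⟨⟨a, d, ha, -, rfl⟩, h0⟩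
      have hd : d = 1 := by
        simp [FieldExpr.eval] at h0
        linear_combination h0
      exact ⟨a, ha, by rw [twistedDiag_eq, hd]⟩
    · rintro K M ⟨⟨a, d, ha, hd, rfl⟩, h0⟩
      have hd : d = -1 := by
        refine hd.resolve_left fun h => h0 ?_
        simp [FieldExpr.eval, h]
      have hx : GOTwistedLetter.toMatrix (m := m) (K.c ()) .x2 =
          fromBlocks !![1, 0; 0, -1] 0 0 1 := by
        ext (i | i) (j | j)
        · fin_cases i <;> fin_cases j <;>
            simp [GOTwistedLetter.toMatrix, e]
          ring
        · simp [GOTwistedLetter.toMatrix, e]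
        · simp [GOTwistedLetter.toMatrix, e]
        · simp [GOTwistedLetter.toMatrix, e, Matrix.one_apply]
      refine ⟨by rintro t s ⟨⟩, fromBlocks !![1, 0; 0, -1] 0 0 1, ?_, a, ha, ?_⟩
      · change GOTwistedLetter.toMatrix (m := m) (K.c ()) .x2 *
          fromBlocks !![1, 0; 0, -1] 0 0 1 = 1
        rw [hx, fromBlocks_multiply]
        refine Eq.trans ?_ fromBlocks_one
        congr 1
        · ext i j
          fin_cases i <;> fin_cases j <;> simp
        all_goals simp
      · rw [twistedDiag_eq, hd, fromBlocks_multiply]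
        congr 1
        · ext i j
          fin_cases i <;> fin_cases j <;> simp
        all_goals simp

theorem exists_goTwistedTree (m : ℕ) : ∃ T : GOTwistedTree m,
    ∀ (k : Type u) [Field k], (2 : k) ≠ 0 → ∀ ε : k, ε ≠ 0 → ∀ g ∈ GOTwisted m ε,
      ∃ (a c : kˣ) (word : List (GOTwistedLetter m k)),
        HasMultiplier (twistedForm m ε) g c ∧
        T.run GOTwistedLetter.map (GOTwistedLetter.toMatrix ε) (fun _ => ε)
          (g : Matrix _ _ k) = (word, twistedDiag m (a : k) (c : k)) ∧
        (g : Matrix _ _ k) =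
          (word.map (GOTwistedLetter.toMatrix ε)).prod * twistedDiag m (a : k) (c : k) ∧
        (∀ t s : k, GOTwistedLetter.x1 t s ∈ word → t ^ 2 + ε * s ^ 2 = (c : k)) ∧
        word.length ≤ 24 * (m + 1) ^ 3 := by
  obtain ⟨T, hT⟩ := (RootDatum.red_stage (S := goTwistedDatum.{u} m)).seq (red_twisted_core m)
  refine ⟨T, fun k _ h2 ε hε g hg => ?_⟩
  obtain ⟨c, hc⟩ := hg
  let K : Ctx.{u} Unit := ⟨k, h2, fun _ => ε, c, c.ne_zero⟩
  obtain ⟨w, M', hr, hM, hgood, hlen, a, ha, rfl⟩ := hT K (g : Matrix _ _ k)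
    (RootDatum.stage_zero (by
      rintro (r | r)
      · fin_cases r
        · exact one_ne_zero
        · exact hε
      · exact one_ne_zero) (by rw [monoForm_goTwisted]; exact hc))
  refine ⟨Units.mk0 a ha, c, w, hc, hr, hM, fun t s h => hgood _ h t s rfl, hlen.trans ?_⟩
  simp only [Fintype.card_sum, Fintype.card_fin]
  nlinarith [Nat.zero_le m, Nat.zero_le (m ^ 3), Nat.zero_le (m ^ 2)]

end SimilitudeWord

theorem theoremA :
    ∃ C : ℕ,
      -- `GSp(2l, k)`
      (∀ l : ℕ, 1 ≤ l → ∃ T : SimilitudeWord.GSpTree l,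
        ∀ (k : Type*) [Field k], (2 : k) ≠ 0 → ∀ g ∈ SimilitudeWord.GSp l k,
          ∃ (c : kˣ) (word : List (SimilitudeWord.GSpLetter l k)),
            SimilitudeWord.HasMultiplier (SimilitudeWord.symplecticForm l k) g c ∧
            T.run SimilitudeWord.GSpLetter.map SimilitudeWord.GSpLetter.toMatrix Empty.elim
                (g : Matrix _ _ k) = (word, SimilitudeWord.evenDiag l 1 (c : k)) ∧
            (g : Matrix _ _ k) =
              (word.map SimilitudeWord.GSpLetter.toMatrix).prod *
                SimilitudeWord.evenDiag l 1 (c : k) ∧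
            word.length ≤ C * l ^ 3) ∧
      -- `GO(2l, k)`
      (∀ l : ℕ, 1 ≤ l → ∃ T : SimilitudeWord.GOEvenTree l,
        ∀ (k : Type*) [Field k], (2 : k) ≠ 0 → ∀ g ∈ SimilitudeWord.GOEven l k,
          ∃ (a c : kˣ) (word : List (SimilitudeWord.GOEvenLetter l k)),
            SimilitudeWord.HasMultiplier (SimilitudeWord.evenForm l k) g c ∧
            T.run SimilitudeWord.GOEvenLetter.map SimilitudeWord.GOEvenLetter.toMatrix Empty.elim
                (g : Matrix _ _ k) = (word, SimilitudeWord.evenDiag l (a : k) (c : k)) ∧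
            (g : Matrix _ _ k) =
              (word.map SimilitudeWord.GOEvenLetter.toMatrix).prod *
                SimilitudeWord.evenDiag l (a : k) (c : k) ∧
            word.length ≤ C * l ^ 3) ∧
      -- `GO(2l+1, k)`
      (∀ l : ℕ, 1 ≤ l → ∃ T : SimilitudeWord.GOOddTree l,
        ∀ (k : Type*) [Field k], (2 : k) ≠ 0 → ∀ g ∈ SimilitudeWord.GOOdd l k,
          ∃ (α a c : kˣ) (word : List (SimilitudeWord.GOOddLetter l k)),
            SimilitudeWord.HasMultiplier (SimilitudeWord.oddForm l k) g c ∧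
            α ^ 2 = c ∧
            T.run SimilitudeWord.GOOddLetter.map SimilitudeWord.GOOddLetter.toMatrix Empty.elim
                (g : Matrix _ _ k) = (word, SimilitudeWord.oddDiag l (α : k) (a : k) (c : k)) ∧
            (g : Matrix _ _ k) =
              (word.map SimilitudeWord.GOOddLetter.toMatrix).prod *
                SimilitudeWord.oddDiag l (α : k) (a : k) (c : k) ∧
            word.length ≤ C * l ^ 3) ∧
      -- `GO⁻(2l, q)` with `l = m + 1`
      (∀ m : ℕ, ∃ T : SimilitudeWord.GOTwistedTree m,
        ∀ (k : Type*) [Field k] [Finite k], (2 : k) ≠ 0 → ∀ ε : k, ¬ IsSquare ε →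
          ∀ g ∈ SimilitudeWord.GOTwisted m ε,
          ∃ (a c : kˣ) (word : List (SimilitudeWord.GOTwistedLetter m k)),
            SimilitudeWord.HasMultiplier (SimilitudeWord.twistedForm m ε) g c ∧
            T.run SimilitudeWord.GOTwistedLetter.map (SimilitudeWord.GOTwistedLetter.toMatrix ε)
                (fun _ => ε) (g : Matrix _ _ k) =
              (word, SimilitudeWord.twistedDiag m (a : k) (c : k)) ∧
            (g : Matrix _ _ k) =
              (word.map (SimilitudeWord.GOTwistedLetter.toMatrix ε)).prod *
                SimilitudeWord.twistedDiag m (a : k) (c : k) ∧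
            (∀ t s : k, SimilitudeWord.GOTwistedLetter.x1 t s ∈ word →
              t ^ 2 + ε * s ^ 2 = (c : k)) ∧
            word.length ≤ C * (m + 1) ^ 3) := by
  exact ⟨24, SimilitudeWord.exists_gspTree, SimilitudeWord.exists_goEvenTree,
    SimilitudeWord.exists_goOddTree, fun m => by
      obtain ⟨T, hT⟩ := SimilitudeWord.exists_goTwistedTree m
      exact ⟨T, fun k _ _ h2 ε hε => hT k h2 ε fun h => hε (h ▸ IsSquare.zero)⟩⟩
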